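/- For an integer $N\ge 1$ and $\mu_A,\mu_B\in(0,1]$, consider the discrete-time elastic random walk on $\{0,1,\dots,N\}$: from $x$ it jumps to $x+1$ and to $x-1$ with probability $\frac12$ each, except that a jump from $0$ to $-1$ is replaced by staying at $0$ with probability $\mu_A/2$ and being killed with probability $(1-\mu_A)/2$, and a jump from $N$ to $N+1$ is replaced by staying at $N$ with probability $\mu_B/2$ and being killed with probability $(1-\mu_B)/2$. Let $p_n^e(x,y)$ be its $n$-step transition function and let $$\mathbf p^R_t(x,y)=e^{-t}\sum_{n\ge 0}\frac{t^n}{n!}\,p^e_n(x,y),\qquad t\ge 0,\ x,y\in\{0,\dots,N\},$$ be the transition function of the corresponding continuous-time walk with rate-one exponential holding times, extended to $x=-1$ and $x=N+1$ by $\mathbf p^R_t(-1,y)=\mu_A\,\mathbf p^R_t(0,y)$ and $\mathbf p^R_t(N+1,y)=\mu_B\,\mathbf p^R_t(N,y)$. (This is the heat kernel of $\frac12\Delta$ on $\{0,\dots,N\}$ with these Robin boundary conditions.) **Proposition.** There is an absolute constant $C_1>0$; for all $A,B>0$ there is a constant $C_2=C_2(A,B)>0$; and for all $A,B>0$, $\bar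 T>0$, $b\ge 0$ there is a constant $C_3=C_3(A,B,b,\bar T)>0$, such that the following holds for every integer $N\ge 1$, with $\varepsilon=1/N$, such that $\mu_A=1-\varepsilon A$ and $\mu_B=1-\varepsilon B$ are positive. For all $0\le t<t'<\varepsilon^{-2}\bar T$, all $v\in[0,1]$, all $x,y\in\{0,\dots,N\}$ and all integers $n$ with $|n|\le\lceil t^{1/2}\rceil$ and $-1\le x+n\le N+1$, $$\mathbf p^R_t(x,y)\le e^{C_1(t'-t)}\,\mathbf p^R_{t'}(x,y),$$ $$|\mathbf p^R_{t'}(x,y)-\mathbf p^R_t(x,y)|\le C_2\,(1\wedge t^{-\frac12-v})\,(t'-t)^v,$$ $$\mathbf p^R_t(x,y)\le C_3\,(1\wedge t^{-\frac12})\,e^{-b|x-y|(1\wedge t^{-1/2})},$$ $$|\mathbf p^R_t(x+n,y)-\mathbf p^R_t(x,y)|\le C_3\,(1\wedge t^{-\frac{1+v}2})\,|n|^v\,e^{-b|x-y|(1\wedge t^{-1/2})},$$ where $1\wedge t^{-r}$ is read as $1$ at $t=0$, and $0^0=1$. -/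

import Mathlib

/-- One-step transition matrix of the discrete time random walk on `{0, …, N}` with elastic
boundaries: from `x` the walk jumps to `x + 1` and to `x - 1` with probability `1/2` each, except
that a jump from `0` to `-1` is replaced by staying at `0` with probability `μA / 2` (and being
killed with probability `(1 - μA) / 2`), and a jump from `N` to `N + 1` is replaced by staying at
`N` with probability `μB / 2` (and being killed with probability `(1 - μB) / 2`). -/
noncomputable def elasticStep (N : ℕ) (μA μB : ℝ) : Matrix (Fin (N + 1)) (Fin (N + 1)) ℝ :=
  fun x y =>
    (if (y : ℕ) = (x : ℕ) + 1 then 1 / 2 else 0) + (if (x : ℕ) = (y : ℕ) + 1 then 1 / 2 else 0)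
      + (if (x : ℕ) = 0 ∧ (y : ℕ) = 0 then μA / 2 else 0)
      + (if (x : ℕ) = N ∧ (y : ℕ) = N then μB / 2 else 0)

/-- Transition function of the continuous time elastic walk on `{0, …, N}`, obtained from the
discrete time walk by exponential holding times of rate one:
`e^{-t} ∑ₙ tⁿ / n! · pₙ(x, y)`, with `pₙ` the `n`-step transition function. -/
noncomputable def elasticKernel (N : ℕ) (μA μB t : ℝ) (x y : Fin (N + 1)) : ℝ :=
  Real.exp (-t) * ∑' n : ℕ, t ^ n / (n.factorial : ℝ) * (elasticStep N μA μB ^ n) x y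

/-- The discrete heat kernel on `{0, …, N}` with Robin boundary conditions, where the first
variable may also take the values `-1` and `N + 1`, at which the kernel is given by
`p_t(-1, y) = μA p_t(0, y)` and `p_t(N + 1, y) = μB p_t(N, y)`. (The value at any other point
outside `{0, …, N}` is a dummy.) -/
noncomputable def robinKernel (N : ℕ) (μA μB t : ℝ) (x : ℤ) (y : Fin (N + 1)) : ℝ :=
  if x = -1 then μA * elasticKernel N μA μB t 0 y
  else if x = (N : ℤ) + 1 then μB * elasticKernel N μA μB t (Fin.last N) y
  else if h : x.toNat < N + 1 then elasticKernel N μA μB t ⟨x.toNat, h⟩ y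
  else 0

/-- `1 ∧ t^{-r}` for `t ≥ 0`, `r ≥ 0`, with the value `1` at `t = 0`. -/
noncomputable def capPow (t r : ℝ) : ℝ := (max 1 t) ^ (-r)

theorem capPow_eq_min {t r : ℝ} (ht : 0 < t) (hr : 0 ≤ r) : capPow t r = min 1 (t ^ (-r)) := by
  unfold capPow
  rcases le_total t 1 with h | h
  · rw [max_eq_left h, Real.one_rpow, min_eq_left]
    exact Real.one_le_rpow_of_pos_of_le_one_of_nonpos ht h (by linarith)
  · rw [max_eq_right h, min_eq_right]
    exact Real.rpow_le_one_of_one_le_of_nonpos h (by linarith)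

theorem capPow_zero (r : ℝ) : capPow 0 r = 1 := by
  simp [capPow]

/-! The kernel is the fundamental solution of `∂ₜ p = (1/2) Δ p` on `{0, …, N}`, where `Δ` is the
discrete Laplacian in the first variable, with the Robin values at `-1` and `N + 1`. -/

section RobinKernel

attribute [local instance] Matrix.linftyOpNormedRing Matrix.linftyOpNormedAlgebra

theorem elasticKernel_eq_exp (N : ℕ) (a b t : ℝ) (x y : Fin (N+1)) :
   elasticKernel N a b t x y = Real.exp (-t) * (NormedSpace.exp (t • elasticStep N a b)) x y := by
  unfold elasticKernel
  congr 1
  have h := NormedSpace.exp_series_hasSum_exp' (𝕂 := ℝ) (t • elasticStep N a b)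
  have h1 : HasSum (fun n : ℕ => ((n.factorial : ℝ)⁻¹ • (t • elasticStep N a b) ^ n) x y)
      ((NormedSpace.exp (t • elasticStep N a b)) x y) :=
    Pi.hasSum.1 (Pi.hasSum.1 h x) y
  rw [← h1.tsum_eq]
  congr 1; ext n
  simp [smul_pow, Matrix.smul_apply]; ring

theorem robinKernel_coe (N : ℕ) (a b t : ℝ) (x y : Fin (N+1)) :
   robinKernel N a b t (x:ℕ) y = elasticKernel N a b t x y := by
  have := x.2
  unfold robinKernel
  rw [if_neg (by omega), if_neg (by omega), dif_pos (by simp; omega)]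
  simp

theorem robinKernel_left (N : ℕ) (a b t : ℝ) (y : Fin (N + 1)) :
    robinKernel N a b t (-1) y = a * robinKernel N a b t 0 y := by
  have := robinKernel_coe N a b t 0 y
  simp only [Fin.val_zero, Nat.cast_zero] at this
  rw [this]; simp [robinKernel]

theorem robinKernel_right (N : ℕ) (a b t : ℝ) (y : Fin (N + 1)) :
    robinKernel N a b t ((N : ℤ) + 1) y = b * robinKernel N a b t N y := by
  have := robinKernel_coe N a b t (Fin.last N) y
  simp only [Fin.val_last] at this
  rw [this]; unfold robinKernel; rw [if_neg (by omega)]; simp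

theorem robinKernel_zero (N : ℕ) (a b : ℝ) (x y : Fin (N+1)) :
   robinKernel N a b 0 (x:ℕ) y = if x = y then 1 else 0 := by
  rw [robinKernel_coe, elasticKernel_eq_exp]; simp [Matrix.one_apply]

theorem elasticStep_mul_elasticKernel (N : ℕ) (a b t : ℝ) (x y : Fin (N+1)) :
  ∑ z, elasticStep N a b x z * elasticKernel N a b t z y =
   1/2 * (robinKernel N a b t ((x:ℕ)+1) y + robinKernel N a b t ((x:ℕ)-1) y) := by
  have hx := x.2
  simp only [elasticStep, add_mul, Finset.sum_add_distrib]
  have e1 : ∑ z : Fin (N+1), (if (z:ℕ) = (x:ℕ)+1 then (1/2:ℝ) else 0) * elasticKernel N a b t z y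
     + ∑ z : Fin (N+1), (if (x:ℕ) = N ∧ (z:ℕ) = N then b/2 else 0) * elasticKernel N a b t z y
     = 1/2 * robinKernel N a b t ((x:ℕ)+1) y := by
    by_cases h : (x:ℕ) = N
    · rw [Finset.sum_eq_zero, Finset.sum_eq_single (Fin.last N)]
      · simp [h, robinKernel]; rw [if_neg (by omega)]; ring
      · intro z _ hz; rw [if_neg, zero_mul]; rintro ⟨_, h2⟩; exact hz (Fin.ext h2)
      · simp
      · intro z _; rw [if_neg (by have := z.2; omega), zero_mul]
    · rw [Finset.sum_eq_single (⟨x+1, by omega⟩ : Fin (N+1)), Finset.sum_eq_zero]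
      · have := robinKernel_coe N a b t ⟨x+1, by omega⟩ y
        push_cast at this
        rw [this]; simp
      · intro z _; rw [if_neg (by omega), zero_mul]
      · intro z _ hz; rw [if_neg, zero_mul]; intro h2; exact hz (Fin.ext h2)
      · simp
  have e2 : ∑ z : Fin (N+1), (if (x:ℕ) = (z:ℕ)+1 then (1/2:ℝ) else 0) * elasticKernel N a b t z y
     + ∑ z : Fin (N+1), (if (x:ℕ) = 0 ∧ (z:ℕ) = 0 then a/2 else 0) * elasticKernel N a b t z y
     = 1/2 * robinKernel N a b t ((x:ℕ)-1) y := by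
    by_cases h : (x:ℕ) = 0
    · rw [Finset.sum_eq_zero, Finset.sum_eq_single 0]
      · simp [h, robinKernel]; ring
      · intro z _ hz; rw [if_neg, zero_mul]; rintro ⟨_, h2⟩; exact hz (Fin.ext h2)
      · simp
      · intro z _; rw [if_neg (by have := z.2; omega), zero_mul]
    · rw [Finset.sum_eq_single (⟨x-1, by omega⟩ : Fin (N+1)), Finset.sum_eq_zero]
      · have := robinKernel_coe N a b t ⟨x-1, by omega⟩ y
        have h3 : (((x:ℕ)-1 : ℕ):ℤ) = (x:ℕ) - 1 := by omega
        simp only [h3] at this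
        rw [this]; simp; intro h4; omega
      · intro z _; rw [if_neg (by omega), zero_mul]
      · intro z _ hz; rw [if_neg, zero_mul]; intro h2; apply hz; ext; simp; omega
      · simp
  rw [mul_add, ← e1, ← e2]; ring

theorem robinKernel_hasDerivAt (N : ℕ) (a b t : ℝ) (x y : Fin (N+1)) :
   HasDerivAt (fun t => robinKernel N a b t (x:ℕ) y)
    (1/2 * (robinKernel N a b t ((x:ℕ)+1) y + robinKernel N a b t ((x:ℕ)-1) y
       - 2 * robinKernel N a b t (x:ℕ) y)) t := by
  simp only [mul_sub, ← elasticStep_mul_elasticKernel, robinKernel_coe, ]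
  have h := hasDerivAt_exp_smul_const' (𝕂 := ℝ) (elasticStep N a b) t
  have h1 := hasDerivAt_pi.1 (hasDerivAt_pi.1 h x) y
  have h2 := ((hasDerivAt_neg t).exp).mul h1
  simp only [elasticKernel_eq_exp]
  refine HasDerivAt.congr_deriv (f := fun t => Real.exp (-t) *
    (NormedSpace.exp (t • elasticStep N a b)) x y) h2 ?_
  rw [Matrix.mul_apply, Finset.mul_sum, add_comm, sub_eq_add_neg]
  congr 1
  · exact Finset.sum_congr rfl fun z _ => mul_left_comm _ _ _
  · ring_nf; rfl

end RobinKernel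

/-!
Write `P` for the one-step matrix, `pₜ` for the continuous time kernel and `s = √(max 1 t)`, so that
`capPow t r = s ^ (-2r)`. Every bound is obtained from an on-diagonal estimate and exponential
moments, by arguments special to dimension one.

* Monotonicity: `eᵗ pₜ` is a power series in `t` with nonnegative coefficients, so that `C₁ = 1`
  works (`elasticKernel_le_exp_mul`).
* On-diagonal decay `pₜ(x, x) ≤ c / s` for all times (`elasticKernel_self_le`). The function
  `u(t) = pₜ(x, x)` is `‖f‖₂²` with `f = p_{t/2}(x, ·)`, and `-u'` is the Dirichlet form of `f`.
  The killing at the endpoint `0`, of order `A / N`, makes the Nash inequality `u³ ≤ -c² u'` hold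
  without a lower order term (`nash_inequality`), and integrating it gives the decay.
* Time increments: with the spectral decomposition `pₜ(x, y) = ∑ e^{-tκ} φ(x) φ(y)`, the inequality
  `κ e^{-tκ} ≤ (2 / t) e^{-tκ/2}` bounds `∑ κ e^{-tκ} |φ(x) φ(y)|` by `4 c / s³`
  (`IsElasticSpectrum.sum_mul_exp_abs_mul_le`). Interpolating between this Lipschitz bound and the
  sup bound gives all exponents `v ∈ [0, 1]`.
* Spatial decay (`elasticKernel_le_exp`): `z ↦ cosh (l (z - x))` satisfies `P ψ ≤ cosh l · ψ` up to
  the boundary, since it increases away from `x` and reflection can only lower it. This bounds the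
  exponential moments of the walk for `l` of order `1 / s`, and the semigroup property turns them
  into pointwise bounds.
* Gradient (`abs_robinKernel_succ_sub_le`): in one dimension the second difference of `pₜ(·, y)` is
  twice the time derivative, hence `O(s⁻³)`. On an interval of length `L` a gradient is at most
  `sup / L + (L - 1) · (second difference)`. The choice `L ≈ s e^{-b|x-y|/s}`, with the decay of
  `pₜ` at rate `2b`, makes both terms `O(s⁻² e^{-b|x-y|/s})`. Only here, and in the Robin condition
  at the exterior points, does the restriction `t < N² T̄` enter: it says that `s` is at most a
  constant times `N`.
-/

/-! ### The one-step matrix -/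

/-- The action of `P` on functions: half the sum over the two neighbours, where the missing neighbour
of an endpoint is replaced by the Robin value. -/
theorem elasticStep_mulVec (N : ℕ) (a b : ℝ) (g : ℕ → ℝ) (x : Fin (N + 1)) :
    ∑ y, elasticStep N a b x y * g y
      = 1 / 2 * (if (x : ℕ) = N then b * g N else g (x + 1))
        + 1 / 2 * (if (x : ℕ) = 0 then a * g 0 else g (x - 1)) := by
  have hx := x.2
  simp only [elasticStep, add_mul, Finset.sum_add_distrib]
  rw [Fin.sum_univ_eq_sum_range
      (fun y => (if y = (x : ℕ) + 1 then (1 / 2 : ℝ) else 0) * g y) (N + 1),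
    Fin.sum_univ_eq_sum_range
      (fun y => (if (x : ℕ) = y + 1 then (1 / 2 : ℝ) else 0) * g y) (N + 1),
    Fin.sum_univ_eq_sum_range
      (fun y => (if (x : ℕ) = 0 ∧ y = 0 then (a / 2 : ℝ) else 0) * g y) (N + 1),
    Fin.sum_univ_eq_sum_range
      (fun y => (if (x : ℕ) = N ∧ y = N then (b / 2 : ℝ) else 0) * g y) (N + 1)]
  have e1 : ∑ y ∈ Finset.range (N + 1), (if y = (x : ℕ) + 1 then (1 / 2 : ℝ) else 0) * g y
      = if (x : ℕ) = N then 0 else 1 / 2 * g (x + 1) := by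
    simp only [ite_mul, zero_mul, Finset.sum_ite_eq', Finset.mem_range]
    split_ifs <;> first | rfl | omega
  have e2 : ∑ y ∈ Finset.range (N + 1), (if (x : ℕ) = y + 1 then (1 / 2 : ℝ) else 0) * g y
      = if (x : ℕ) = 0 then 0 else 1 / 2 * g (x - 1) := by
    by_cases h : (x : ℕ) = 0
    · simp [h]
    · have h' : ∀ y : ℕ, (x : ℕ) = y + 1 ↔ y = (x : ℕ) - 1 := fun y => by omega
      simp only [h', ite_mul, zero_mul, Finset.sum_ite_eq', Finset.mem_range, if_neg h]
      rw [if_pos (by omega)]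
  have e3 : ∑ y ∈ Finset.range (N + 1), (if (x : ℕ) = 0 ∧ y = 0 then (a / 2 : ℝ) else 0) * g y
      = if (x : ℕ) = 0 then a / 2 * g 0 else 0 := by
    by_cases h : (x : ℕ) = 0 <;> simp [h, ite_mul]
  have e4 : ∑ y ∈ Finset.range (N + 1), (if (x : ℕ) = N ∧ y = N then (b / 2 : ℝ) else 0) * g y
      = if (x : ℕ) = N then b / 2 * g N else 0 := by
    by_cases h : (x : ℕ) = N <;> simp [h, ite_mul]
  rw [e1, e2, e3, e4]
  split_ifs <;> ring

theorem elasticStep_nonneg {N : ℕ} {a b : ℝ} (ha : 0 ≤ a) (hb : 0 ≤ b) (x y : Fin (N + 1)) :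
    0 ≤ elasticStep N a b x y := by
  unfold elasticStep
  split_ifs <;> linarith

theorem elasticStep_symm (N : ℕ) (a b : ℝ) (x y : Fin (N + 1)) :
    elasticStep N a b x y = elasticStep N a b y x := by
  unfold elasticStep
  simp only [and_comm (a := (x : ℕ) = 0), and_comm (a := (x : ℕ) = N),
    add_comm (if (y : ℕ) = (x : ℕ) + 1 then (1 / 2 : ℝ) else 0)]

theorem sum_elasticStep_le_one {N : ℕ} {a b : ℝ} (ha : a ≤ 1) (hb : b ≤ 1) (x : Fin (N + 1)) :
    ∑ y, elasticStep N a b x y ≤ 1 := by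
  have h := elasticStep_mulVec N a b (fun _ => 1) x
  simp only [mul_one] at h
  rw [h]
  split_ifs <;> linarith

theorem elasticStep_pow_nonneg {N : ℕ} {a b : ℝ} (ha : 0 ≤ a) (hb : 0 ≤ b) (n : ℕ)
    (x y : Fin (N + 1)) : 0 ≤ (elasticStep N a b ^ n) x y := by
  induction n generalizing x y with
  | zero => simp only [pow_zero, Matrix.one_apply]; split_ifs <;> norm_num
  | succ n ih =>
    rw [pow_succ, Matrix.mul_apply]
    exact Finset.sum_nonneg fun z _ => mul_nonneg (ih x z) (elasticStep_nonneg ha hb z y)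

/-- The quadratic form of `1 - P` is the Dirichlet form of the interval with a mass at each
endpoint proportional to the killing probability there. -/
theorem dirichletForm_eq (N : ℕ) (a b : ℝ) (g : ℕ → ℝ) :
    ∑ x : Fin (N + 1), g x * (g x - ∑ y, elasticStep N a b x y * g y)
      = 1 / 2 * ∑ i ∈ Finset.range N, (g (i + 1) - g i) ^ 2
        + (1 - a) / 2 * g 0 ^ 2 + (1 - b) / 2 * g N ^ 2 := by
  simp only [elasticStep_mulVec]
  rw [Fin.sum_univ_eq_sum_range (fun x => g x * (g x -
    (1 / 2 * (if x = N then b * g N else g (x + 1))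
        + 1 / 2 * (if x = 0 then a * g 0 else g (x - 1))))) (N + 1)]
  have e1 : ∑ x ∈ Finset.range (N + 1), g x * (1 / 2 * g x -
      1 / 2 * (if x = N then b * g N else g (x + 1)))
      = ∑ x ∈ Finset.range N, g x * (1 / 2 * g x - 1 / 2 * g (x + 1))
        + (1 - b) / 2 * g N ^ 2 := by
    rw [Finset.sum_range_succ, if_pos rfl]
    congr 1
    · refine Finset.sum_congr rfl fun x hx => ?_
      rw [if_neg (Finset.mem_range.1 hx).ne]
    · ring
  have e2 : ∑ x ∈ Finset.range (N + 1), g x * (1 / 2 * g x -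
      1 / 2 * (if x = 0 then a * g 0 else g (x - 1)))
      = ∑ x ∈ Finset.range N, g (x + 1) * (1 / 2 * g (x + 1) - 1 / 2 * g x)
        + (1 - a) / 2 * g 0 ^ 2 := by
    rw [Finset.sum_range_succ', if_pos rfl]
    congr 1
    ring
  calc _ = ∑ x ∈ Finset.range (N + 1), g x * (1 / 2 * g x -
      1 / 2 * (if x = N then b * g N else g (x + 1))) + ∑ x ∈ Finset.range (N + 1),
        g x * (1 / 2 * g x - 1 / 2 * (if x = 0 then a * g 0 else g (x - 1))) := by
        rw [← Finset.sum_add_distrib]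
        exact Finset.sum_congr rfl fun x _ => by ring
    _ = _ := by
        rw [e1, e2, add_add_add_comm, ← Finset.sum_add_distrib, Finset.mul_sum, add_assoc,
          add_comm ((1 - b) / 2 * g N ^ 2)]
        congr 1
        exact Finset.sum_congr rfl fun x _ => by ring

/-! ### Power series, positivity and supersolutions -/

section PowerSeries

attribute [local instance] Matrix.linftyOpNormedRing Matrix.linftyOpNormedAlgebra

theorem hasSum_elasticKernel (N : ℕ) (a b t : ℝ) (x y : Fin (N + 1)) :
    HasSum (fun n : ℕ => t ^ n / (n.factorial : ℝ) * (elasticStep N a b ^ n) x y)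
      (Real.exp t * elasticKernel N a b t x y) := by
  have h := NormedSpace.exp_series_hasSum_exp' (𝕂 := ℝ) (t • elasticStep N a b)
  have h1 : HasSum (fun n : ℕ => ((n.factorial : ℝ)⁻¹ • (t • elasticStep N a b) ^ n) x y)
      ((NormedSpace.exp (t • elasticStep N a b)) x y) :=
    Pi.hasSum.1 (Pi.hasSum.1 h x) y
  rw [elasticKernel_eq_exp, ← mul_assoc, ← Real.exp_add, add_neg_cancel, Real.exp_zero, one_mul]
  convert h1 using 2 with n
  simp [smul_pow, Matrix.smul_apply]; ring

end PowerSeries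

theorem elasticKernel_nonneg {N : ℕ} {a b t : ℝ} (ha : 0 ≤ a) (hb : 0 ≤ b) (ht : 0 ≤ t)
    (x y : Fin (N + 1)) : 0 ≤ elasticKernel N a b t x y := by
  unfold elasticKernel
  exact mul_nonneg (Real.exp_pos _).le (tsum_nonneg fun n =>
    mul_nonneg (by positivity) (elasticStep_pow_nonneg ha hb n x y))

/-- `eᵗ pₜ` is a power series in `t` with nonnegative coefficients, hence nondecreasing. -/
theorem elasticKernel_le_exp_mul {N : ℕ} {a b t t' : ℝ} (ha : 0 ≤ a) (hb : 0 ≤ b) (ht : 0 ≤ t)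
    (htt : t ≤ t') (x y : Fin (N + 1)) :
    elasticKernel N a b t x y ≤ Real.exp (t' - t) * elasticKernel N a b t' x y := by
  have h : Real.exp t * elasticKernel N a b t x y ≤ Real.exp t' * elasticKernel N a b t' x y := by
    refine hasSum_le (fun n => ?_) (hasSum_elasticKernel N a b t x y)
      (hasSum_elasticKernel N a b t' x y)
    have := elasticStep_pow_nonneg ha hb n x y
    gcongr
  calc elasticKernel N a b t x y
      = Real.exp (-t) * (Real.exp t * elasticKernel N a b t x y) := by
        rw [← mul_assoc, ← Real.exp_add, neg_add_cancel, Real.exp_zero, one_mul]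
    _ ≤ Real.exp (-t) * (Real.exp t' * elasticKernel N a b t' x y) := by gcongr
    _ = _ := by rw [← mul_assoc, ← Real.exp_add]; ring_nf

/-- A function `ψ` with `P ψ ≤ c ψ` grows at most at rate `c - 1` under the continuous time
semigroup. -/
theorem sum_elasticKernel_mul_le {N : ℕ} {a b t c : ℝ} (ha : 0 ≤ a) (hb : 0 ≤ b) (ht : 0 ≤ t)
    (hc : 0 ≤ c) {ψ : Fin (N + 1) → ℝ} (hψ : ∀ x, ∑ y, elasticStep N a b x y * ψ y ≤ c * ψ x)
    (x : Fin (N + 1)) :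
    ∑ y, elasticKernel N a b t x y * ψ y ≤ Real.exp ((c - 1) * t) * ψ x := by
  have hpow : ∀ (n : ℕ) (x : Fin (N + 1)),
      ∑ y, (elasticStep N a b ^ n) x y * ψ y ≤ c ^ n * ψ x := by
    intro n
    induction n with
    | zero => intro x; simp [Matrix.one_apply]
    | succ n ih =>
      intro x
      calc ∑ y, (elasticStep N a b ^ (n + 1)) x y * ψ y
          = ∑ z, elasticStep N a b x z * ∑ y, (elasticStep N a b ^ n) z y * ψ y := by
            simp only [pow_succ', Matrix.mul_apply, Finset.sum_mul, Finset.mul_sum]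
            rw [Finset.sum_comm]
            exact Finset.sum_congr rfl fun _ _ => Finset.sum_congr rfl fun _ _ => by ring
        _ ≤ ∑ z, elasticStep N a b x z * (c ^ n * ψ z) := Finset.sum_le_sum fun z _ =>
            mul_le_mul_of_nonneg_left (ih z) (elasticStep_nonneg ha hb x z)
        _ = c ^ n * ∑ z, elasticStep N a b x z * ψ z := by
            rw [Finset.mul_sum]; exact Finset.sum_congr rfl fun _ _ => by ring
        _ ≤ c ^ n * (c * ψ x) := mul_le_mul_of_nonneg_left (hψ x) (by positivity)
        _ = c ^ (n + 1) * ψ x := by ring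
  have h1 : HasSum (fun n : ℕ => ∑ y, t ^ n / (n.factorial : ℝ) * (elasticStep N a b ^ n) x y * ψ y)
      (∑ y, Real.exp t * elasticKernel N a b t x y * ψ y) :=
    hasSum_sum fun y _ => (hasSum_elasticKernel N a b t x y).mul_right _
  have h2 : HasSum (fun n : ℕ => (t * c) ^ n / (n.factorial : ℝ) * ψ x)
      (Real.exp (t * c) * ψ x) := by
    have := NormedSpace.expSeries_div_hasSum_exp (t * c)
    rw [← Real.exp_eq_exp_ℝ] at this
    exact this.mul_right _
  have h3 : ∑ y, Real.exp t * elasticKernel N a b t x y * ψ y ≤ Real.exp (t * c) * ψ x := by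
    refine hasSum_le (fun n => ?_) h1 h2
    calc ∑ y, t ^ n / (n.factorial : ℝ) * (elasticStep N a b ^ n) x y * ψ y
        = t ^ n / (n.factorial : ℝ) * ∑ y, (elasticStep N a b ^ n) x y * ψ y := by
          rw [Finset.mul_sum]; exact Finset.sum_congr rfl fun _ _ => by ring
      _ ≤ t ^ n / (n.factorial : ℝ) * (c ^ n * ψ x) :=
          mul_le_mul_of_nonneg_left (hpow n x) (by positivity)
      _ = (t * c) ^ n / (n.factorial : ℝ) * ψ x := by rw [mul_pow]; ring
  calc ∑ y, elasticKernel N a b t x y * ψ y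
      = Real.exp (-t) * ∑ y, Real.exp t * elasticKernel N a b t x y * ψ y := by
        rw [Finset.mul_sum]
        refine Finset.sum_congr rfl fun y _ => ?_
        rw [← mul_assoc, ← mul_assoc, ← Real.exp_add, neg_add_cancel, Real.exp_zero, one_mul]
    _ ≤ Real.exp (-t) * (Real.exp (t * c) * ψ x) := by gcongr
    _ = _ := by rw [← mul_assoc, ← Real.exp_add]; ring_nf

theorem sum_elasticKernel_le_one {N : ℕ} {a b t : ℝ} (ha : 0 ≤ a) (ha1 : a ≤ 1) (hb : 0 ≤ b)
    (hb1 : b ≤ 1) (ht : 0 ≤ t) (x : Fin (N + 1)) : ∑ y, elasticKernel N a b t x y ≤ 1 := by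
  have := sum_elasticKernel_mul_le (ψ := fun _ => 1) ha hb ht zero_le_one
    (fun x => by simpa using sum_elasticStep_le_one ha1 hb1 x) x
  simpa using this

/-- Exponential moments. The function `z ↦ cosh (l (z - x))` is an eigenfunction of the walk on `ℤ`
and its minimum is at the interior point `x`, so that reflection at the endpoints only lowers it. -/
theorem sum_elasticKernel_mul_cosh_le {N : ℕ} {a b t : ℝ} (l : ℝ) (ha : 0 ≤ a) (ha1 : a ≤ 1)
    (hb : 0 ≤ b) (hb1 : b ≤ 1) (ht : 0 ≤ t) (x : Fin (N + 1)) :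
    ∑ y, elasticKernel N a b t x y * Real.cosh (l * ((y : ℕ) - (x : ℕ) : ℝ))
      ≤ Real.exp ((Real.cosh l - 1) * t) := by
  have hx : (x : ℕ) ≤ N := Nat.lt_succ_iff.1 x.2
  have h := sum_elasticKernel_mul_le (N := N) (c := Real.cosh l)
    (ψ := fun z => Real.cosh (l * ((z : ℕ) - (x : ℕ) : ℝ))) ha hb ht (Real.cosh_pos l).le ?_ x
  · simpa using h
  intro z
  rw [elasticStep_mulVec N a b (fun z => Real.cosh (l * ((z : ℝ) - (x : ℕ)))) z]
  have hz : (z : ℕ) ≤ N := Nat.lt_succ_iff.1 z.2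
  have key : Real.cosh l * Real.cosh (l * ((z : ℕ) - (x : ℕ) : ℝ))
      = 1 / 2 * Real.cosh (l * ((z : ℕ) + 1 - (x : ℕ) : ℝ))
        + 1 / 2 * Real.cosh (l * ((z : ℕ) - 1 - (x : ℕ) : ℝ)) := by
    rw [show l * ((z : ℕ) + 1 - (x : ℕ) : ℝ) = l * ((z : ℕ) - (x : ℕ) : ℝ) + l by ring,
      show l * ((z : ℕ) - 1 - (x : ℕ) : ℝ) = l * ((z : ℕ) - (x : ℕ) : ℝ) - l by ring,
      Real.cosh_add, Real.cosh_sub]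
    ring
  rw [key]
  have hmono : ∀ (m : ℝ) (u v : ℝ), 0 ≤ m → m ≤ 1 → |u| ≤ |v| →
      m * Real.cosh (l * u) ≤ Real.cosh (l * v) := by
    intro m u v hm hm1 huv
    refine (mul_le_of_le_one_left (Real.cosh_pos _).le hm1).trans ?_
    rw [Real.cosh_le_cosh, abs_mul, abs_mul]
    gcongr
  refine add_le_add (mul_le_mul_of_nonneg_left ?_ (by norm_num))
    (mul_le_mul_of_nonneg_left ?_ (by norm_num))
  · split_ifs with h
    · refine hmono b _ _ hb hb1 ?_
      have : ((x : ℕ) : ℝ) ≤ N := by exact_mod_cast hx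
      rw [h, abs_of_nonneg (by linarith), abs_of_nonneg (by linarith)]
      linarith
    · push_cast; exact le_rfl
  · split_ifs with h
    · refine hmono a _ _ ha ha1 ?_
      have : (0 : ℝ) ≤ (x : ℕ) := by positivity
      rw [h, Nat.cast_zero, abs_of_nonpos (by linarith), abs_of_nonpos (by linarith)]
      linarith
    · rw [Nat.cast_sub (by omega)]; push_cast; exact le_rfl

/-! ### Spectral decomposition -/

/-- A spectral decomposition of `1 - P`: an orthonormal basis `φ` of eigenvectors with
eigenvalues `κ`. -/
structure IsElasticSpectrum (N : ℕ) (a b : ℝ) (κ : Fin (N + 1) → ℝ)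
    (φ : Fin (N + 1) → Fin (N + 1) → ℝ) : Prop where
  complete : ∀ x y, ∑ j, φ j x * φ j y = if x = y then 1 else 0
  orthonormal : ∀ i j, ∑ x, φ i x * φ j x = if i = j then 1 else 0
  eigen : ∀ j x, ∑ y, elasticStep N a b x y * φ j y = (1 - κ j) * φ j x

theorem exists_isElasticSpectrum (N : ℕ) (a b : ℝ) : ∃ κ φ, IsElasticSpectrum N a b κ φ := by
  have hH : (elasticStep N a b).IsHermitian := by
    ext x y
    simpa using elasticStep_symm N a b y x
  have hU1 : (hH.eigenvectorUnitary : Matrix (Fin (N + 1)) (Fin (N + 1)) ℝ)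
      * star (hH.eigenvectorUnitary : Matrix (Fin (N + 1)) (Fin (N + 1)) ℝ) = 1 :=
    Unitary.coe_mul_star_self _
  have hU2 : star (hH.eigenvectorUnitary : Matrix (Fin (N + 1)) (Fin (N + 1)) ℝ)
      * (hH.eigenvectorUnitary : Matrix (Fin (N + 1)) (Fin (N + 1)) ℝ) = 1 :=
    Unitary.coe_star_mul_self _
  refine ⟨fun j => 1 - hH.eigenvalues j, fun j x => hH.eigenvectorBasis j x, ?_, ?_, ?_⟩
  · intro x y
    have := congrFun (congrFun hU1 x) y
    simpa [Matrix.mul_apply, Matrix.one_apply, Matrix.star_apply] using this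
  · intro i j
    have := congrFun (congrFun hU2 i) j
    simpa [Matrix.mul_apply, Matrix.one_apply, Matrix.star_apply] using this
  · intro j x
    have := congrFun (hH.mulVec_eigenvectorBasis j) x
    simpa [Matrix.mulVec, dotProduct] using this

namespace IsElasticSpectrum

variable {N : ℕ} {a b : ℝ} {κ : Fin (N + 1) → ℝ} {φ : Fin (N + 1) → Fin (N + 1) → ℝ}

theorem elasticStep_pow_eq (h : IsElasticSpectrum N a b κ φ) (n : ℕ) (x y : Fin (N + 1)) :
    (elasticStep N a b ^ n) x y = ∑ j, (1 - κ j) ^ n * (φ j x * φ j y) := by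
  induction n generalizing x with
  | zero => simp [Matrix.one_apply, h.complete]
  | succ n ih =>
    simp only [pow_succ' (elasticStep N a b), Matrix.mul_apply, ih, Finset.mul_sum]
    rw [Finset.sum_comm]
    refine Finset.sum_congr rfl fun j _ => ?_
    calc ∑ z, elasticStep N a b x z * ((1 - κ j) ^ n * (φ j z * φ j y))
        = (∑ z, elasticStep N a b x z * φ j z) * ((1 - κ j) ^ n * φ j y) := by
          rw [Finset.sum_mul]; exact Finset.sum_congr rfl fun _ _ => by ring
      _ = _ := by rw [h.eigen]; ring

theorem elasticKernel_eq (h : IsElasticSpectrum N a b κ φ) (t : ℝ) (x y : Fin (N + 1)) :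
    elasticKernel N a b t x y = ∑ j, Real.exp (-(t * κ j)) * (φ j x * φ j y) := by
  have h1 : HasSum (fun n : ℕ => t ^ n / (n.factorial : ℝ) * (elasticStep N a b ^ n) x y)
      (∑ j, Real.exp (t * (1 - κ j)) * (φ j x * φ j y)) := by
    have : ∀ j ∈ Finset.univ, HasSum
        (fun n : ℕ => (t * (1 - κ j)) ^ n / (n.factorial : ℝ) * (φ j x * φ j y))
        (Real.exp (t * (1 - κ j)) * (φ j x * φ j y)) := by
      intro j _
      have := NormedSpace.expSeries_div_hasSum_exp (t * (1 - κ j))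
      rw [← Real.exp_eq_exp_ℝ] at this
      exact this.mul_right _
    convert hasSum_sum this using 2 with n
    rw [h.elasticStep_pow_eq, Finset.mul_sum]
    exact Finset.sum_congr rfl fun j _ => by rw [mul_pow]; ring
  have h2 := (hasSum_elasticKernel N a b t x y).unique h1
  calc elasticKernel N a b t x y
      = Real.exp (-t) * (Real.exp t * elasticKernel N a b t x y) := by
        rw [← mul_assoc, ← Real.exp_add, neg_add_cancel, Real.exp_zero, one_mul]
    _ = _ := by
        rw [h2, Finset.mul_sum]
        refine Finset.sum_congr rfl fun j _ => ?_
        rw [← mul_assoc, ← Real.exp_add]; ring_nf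

/-- The eigenvalues of `P` lie in `[-1, 1]`, because `P` is symmetric with row sums at most one. -/
theorem eigenvalue_bounds (h : IsElasticSpectrum N a b κ φ) (ha : 0 ≤ a) (ha1 : a ≤ 1)
    (hb : 0 ≤ b) (hb1 : b ≤ 1) (j : Fin (N + 1)) : 0 ≤ κ j ∧ κ j ≤ 2 := by
  have hn : ∑ x, φ j x ^ 2 = 1 := by simpa [sq] using h.orthonormal j j
  have hq : 1 - κ j = ∑ x, ∑ y, elasticStep N a b x y * (φ j x * φ j y) := by
    calc 1 - κ j = (1 - κ j) * ∑ x, φ j x ^ 2 := by rw [hn, mul_one]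
      _ = ∑ x, φ j x * ((1 - κ j) * φ j x) := by
          rw [Finset.mul_sum]; exact Finset.sum_congr rfl fun _ _ => by ring
      _ = _ := by
          refine Finset.sum_congr rfl fun x _ => ?_
          rw [← h.eigen, Finset.mul_sum]
          exact Finset.sum_congr rfl fun _ _ => by ring
  have hrow : ∑ x, ∑ y, elasticStep N a b x y * φ j x ^ 2 ≤ 1 := by
    rw [← hn]
    refine Finset.sum_le_sum fun x _ => ?_
    rw [← Finset.sum_mul]
    exact mul_le_of_le_one_left (sq_nonneg _) (sum_elasticStep_le_one ha1 hb1 x)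
  have hcol : ∑ x, ∑ y, elasticStep N a b x y * φ j y ^ 2 ≤ 1 := by
    rw [Finset.sum_comm]
    simpa only [elasticStep_symm N a b] using hrow
  have habs : |1 - κ j| ≤ 1 := by
    rw [hq]
    calc |∑ x, ∑ y, elasticStep N a b x y * (φ j x * φ j y)|
        ≤ ∑ x, ∑ y, |elasticStep N a b x y * (φ j x * φ j y)| :=
          (Finset.abs_sum_le_sum_abs _ _).trans
            (Finset.sum_le_sum fun x _ => Finset.abs_sum_le_sum_abs _ _)
      _ ≤ ∑ x, ∑ y, (1 / 2 * (elasticStep N a b x y * φ j x ^ 2)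
            + 1 / 2 * (elasticStep N a b x y * φ j y ^ 2)) := by
          refine Finset.sum_le_sum fun x _ => Finset.sum_le_sum fun y _ => ?_
          have h0 := elasticStep_nonneg ha hb x y
          rw [abs_mul, abs_of_nonneg h0, abs_mul]
          nlinarith [mul_nonneg h0 (sq_nonneg (|φ j x| - |φ j y|)), sq_abs (φ j x),
            sq_abs (φ j y)]
      _ = 1 / 2 * ∑ x, ∑ y, elasticStep N a b x y * φ j x ^ 2
            + 1 / 2 * ∑ x, ∑ y, elasticStep N a b x y * φ j y ^ 2 := by
          simp only [Finset.sum_add_distrib, Finset.mul_sum]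
      _ ≤ 1 := by linarith
  rw [abs_le] at habs
  constructor <;> linarith

theorem elasticKernel_symm (h : IsElasticSpectrum N a b κ φ) (t : ℝ) (x y : Fin (N + 1)) :
    elasticKernel N a b t x y = elasticKernel N a b t y x := by
  simp only [h.elasticKernel_eq, mul_comm (φ _ x)]

/-- Composition of two functions of `P`: the spectral multipliers multiply. -/
theorem sum_mul_sum_eq (h : IsElasticSpectrum N a b κ φ) (c d : Fin (N + 1) → ℝ)
    (x y : Fin (N + 1)) :
    ∑ z, (∑ i, c i * (φ i x * φ i z)) * (∑ j, d j * (φ j z * φ j y))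
      = ∑ j, c j * d j * (φ j x * φ j y) := by
  calc ∑ z, (∑ i, c i * (φ i x * φ i z)) * (∑ j, d j * (φ j z * φ j y))
      = ∑ z, ∑ i, ∑ j, (c i * φ i x * (d j * φ j y)) * (φ i z * φ j z) := by
        refine Finset.sum_congr rfl fun z _ => ?_
        rw [Finset.sum_mul_sum]
        exact Finset.sum_congr rfl fun _ _ => Finset.sum_congr rfl fun _ _ => by ring
    _ = ∑ i, ∑ j, (c i * φ i x * (d j * φ j y)) * ∑ z, φ i z * φ j z := by
        rw [Finset.sum_comm]
        refine Finset.sum_congr rfl fun i _ => ?_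
        rw [Finset.sum_comm]
        exact Finset.sum_congr rfl fun j _ => (Finset.mul_sum _ _ _).symm
    _ = _ := by
        refine Finset.sum_congr rfl fun i _ => ?_
        simp only [h.orthonormal, mul_ite, mul_one, mul_zero, Finset.sum_ite_eq, Finset.mem_univ,
          if_true]
        ring

theorem elasticKernel_semigroup (h : IsElasticSpectrum N a b κ φ) (s t : ℝ) (x y : Fin (N + 1)) :
    ∑ z, elasticKernel N a b s x z * elasticKernel N a b t z y
      = elasticKernel N a b (s + t) x y := by
  simp only [h.elasticKernel_eq, h.sum_mul_sum_eq, ← Real.exp_add]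
  exact Finset.sum_congr rfl fun j _ => by ring_nf

theorem sub_sum_elasticStep_mul (h : IsElasticSpectrum N a b κ φ) (t : ℝ) (x y : Fin (N + 1)) :
    elasticKernel N a b t x y - ∑ z, elasticStep N a b x z * elasticKernel N a b t z y
      = ∑ j, κ j * Real.exp (-(t * κ j)) * (φ j x * φ j y) := by
  have : ∑ z, elasticStep N a b x z * elasticKernel N a b t z y
      = ∑ j, Real.exp (-(t * κ j)) * ((1 - κ j) * φ j x * φ j y) := by
    simp only [h.elasticKernel_eq, Finset.mul_sum, ← h.eigen, Finset.sum_mul]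
    rw [Finset.sum_comm]
    exact Finset.sum_congr rfl fun _ _ => Finset.sum_congr rfl fun _ _ => by ring
  rw [this, h.elasticKernel_eq, ← Finset.sum_sub_distrib]
  exact Finset.sum_congr rfl fun _ _ => by ring

/-- With `f = p_{t/2}(x, ·)`, the Dirichlet form of `f` is minus the time derivative of
`pₜ(x, x) = ‖f‖²`. -/
theorem dirichletForm_elasticKernel (h : IsElasticSpectrum N a b κ φ) (t : ℝ) (x : Fin (N + 1)) :
    ∑ y, elasticKernel N a b (t / 2) x y * (elasticKernel N a b (t / 2) x y
        - ∑ z, elasticStep N a b y z * elasticKernel N a b (t / 2) x z)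
      = ∑ j, κ j * Real.exp (-(t * κ j)) * φ j x ^ 2 := by
  simp only [h.elasticKernel_symm (t / 2) x, h.sub_sum_elasticStep_mul]
  simp only [← h.elasticKernel_symm (t / 2) x]
  simp only [h.elasticKernel_eq, h.sum_mul_sum_eq]
  refine Finset.sum_congr rfl fun j _ => ?_
  have he : Real.exp (-(t * κ j)) = Real.exp (-(t / 2 * κ j)) * Real.exp (-(t / 2 * κ j)) := by
    rw [← Real.exp_add]; ring_nf
  rw [he]
  ring

end IsElasticSpectrum

/-! ### Nash inequality and on-diagonal decay -/

/-- Cauchy–Schwarz for the telescoping sum of `f (i + 1) ^ 2 - f i ^ 2`. -/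
theorem abs_sq_sub_sq_le_sqrt {N : ℕ} (f : ℕ → ℝ) {E : ℝ}
    (hE : 1 / 2 * ∑ i ∈ Finset.range N, (f (i + 1) - f i) ^ 2 ≤ E) {x : ℕ} (hx : x ≤ N) :
    |f x ^ 2 - f 0 ^ 2| ≤ 3 * √(E * ∑ i ∈ Finset.range (N + 1), f i ^ 2) := by
  set S := ∑ i ∈ Finset.range (N + 1), f i ^ 2 with hS
  have hS0 : 0 ≤ S := Finset.sum_nonneg fun _ _ => sq_nonneg _
  have hD0 : 0 ≤ ∑ i ∈ Finset.range N, (f (i + 1) - f i) ^ 2 :=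
    Finset.sum_nonneg fun _ _ => sq_nonneg _
  have h4 : ∑ i ∈ Finset.range N, (f (i + 1) + f i) ^ 2 ≤ 4 * S := by
    have e1 : ∑ i ∈ Finset.range N, f i ^ 2 ≤ S :=
      Finset.sum_le_sum_of_subset_of_nonneg (by simp) fun _ _ _ => sq_nonneg _
    have e2 : ∑ i ∈ Finset.range N, f (i + 1) ^ 2 ≤ S := by
      rw [hS, Finset.sum_range_succ']; linarith [sq_nonneg (f 0)]
    calc ∑ i ∈ Finset.range N, (f (i + 1) + f i) ^ 2
        ≤ ∑ i ∈ Finset.range N, (2 * f (i + 1) ^ 2 + 2 * f i ^ 2) :=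
          Finset.sum_le_sum fun i _ => by nlinarith [sq_nonneg (f (i + 1) - f i)]
      _ = 2 * ∑ i ∈ Finset.range N, f (i + 1) ^ 2 + 2 * ∑ i ∈ Finset.range N, f i ^ 2 := by
          rw [Finset.sum_add_distrib, Finset.mul_sum, Finset.mul_sum]
      _ ≤ 4 * S := by linarith
  have hcs : (∑ i ∈ Finset.range N, |f (i + 1) - f i| * |f (i + 1) + f i|) ^ 2 ≤ 9 * (E * S) := by
    refine (Finset.sum_mul_sq_le_sq_mul_sq _ _ _).trans ?_
    simp only [sq_abs]
    calc _ ≤ (2 * E) * (4 * S) := mul_le_mul (by linarith) h4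
          (Finset.sum_nonneg fun _ _ => sq_nonneg _) (by linarith)
      _ ≤ 9 * (E * S) := by nlinarith [mul_nonneg (show 0 ≤ E by linarith) hS0]
  calc |f x ^ 2 - f 0 ^ 2| = |∑ i ∈ Finset.range x, (f (i + 1) ^ 2 - f i ^ 2)| := by
        rw [Finset.sum_range_sub (fun i => f i ^ 2)]
    _ ≤ ∑ i ∈ Finset.range x, |f (i + 1) - f i| * |f (i + 1) + f i| := by
        refine (Finset.abs_sum_le_sum_abs _ _).trans (Finset.sum_le_sum fun i _ => ?_)
        rw [← abs_mul]; exact le_of_eq (by ring_nf)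
    _ ≤ ∑ i ∈ Finset.range N, |f (i + 1) - f i| * |f (i + 1) + f i| :=
        Finset.sum_le_sum_of_subset_of_nonneg (by simpa using hx) fun _ _ _ => by positivity
    _ ≤ √(9 * (E * S)) := Real.le_sqrt_of_sq_le hcs
    _ = 3 * √(E * S) := by
        rw [Real.sqrt_mul (by norm_num), show (9 : ℝ) = 3 ^ 2 by norm_num,
          Real.sqrt_sq (by norm_num)]

/-- Agmon's inequality for the Robin Dirichlet form. The boundary mass `A / N` at `0` matches the
average of `f ^ 2` over the interval, so that no zeroth order term appears on the right. -/
theorem sq_le_sqrt_dirichletForm {N : ℕ} (hN : 1 ≤ N) {A : ℝ} (hA : 0 < A) (f : ℕ → ℝ) {E : ℝ}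
    (hE : 1 / 2 * ∑ i ∈ Finset.range N, (f (i + 1) - f i) ^ 2 + A / N / 2 * f 0 ^ 2 ≤ E)
    {x : ℕ} (hx : x ≤ N) :
    f x ^ 2 ≤ (6 + 2 / A) * √(E * ∑ i ∈ Finset.range (N + 1), f i ^ 2) := by
  have hN' : (0 : ℝ) < N := by exact_mod_cast hN
  have hb0 : 0 ≤ A / N / 2 * f 0 ^ 2 := by positivity
  have hD0 : 0 ≤ ∑ i ∈ Finset.range N, (f (i + 1) - f i) ^ 2 :=
    Finset.sum_nonneg fun _ _ => sq_nonneg _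
  have hvar := fun x (hx : x ≤ N) => abs_sq_sub_sq_le_sqrt f (E := E) (by linarith) hx
  have hES : √(E * ∑ i ∈ Finset.range (N + 1), f i ^ 2) ^ 2
      = E * ∑ i ∈ Finset.range (N + 1), f i ^ 2 :=
    Real.sq_sqrt (mul_nonneg (by linarith) (Finset.sum_nonneg fun _ _ => sq_nonneg _))
  set S := ∑ i ∈ Finset.range (N + 1), f i ^ 2 with hS
  set m := √(E * S)
  have hm : 0 ≤ m := Real.sqrt_nonneg _
  set X := f 0 ^ 2 with hX
  have hX0 : 0 ≤ X := sq_nonneg _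
  have havg : N * (X - 3 * m) ≤ S := by
    rcases le_total X (3 * m) with h | h
    · exact (mul_nonpos_of_nonneg_of_nonpos hN'.le (by linarith)).trans
        (Finset.sum_nonneg fun _ _ => sq_nonneg _)
    calc (N : ℝ) * (X - 3 * m) ≤ (N + 1 : ℕ) * (X - 3 * m) := by
          push_cast; nlinarith
      _ = ∑ i ∈ Finset.range (N + 1), (X - 3 * m) := by
          rw [Finset.sum_const, Finset.card_range, nsmul_eq_mul]
      _ ≤ S := Finset.sum_le_sum fun i hi => by
          have := (abs_le.1 (hvar i (Nat.lt_succ_iff.1 (Finset.mem_range.1 hi)))).1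
          linarith
  -- One factor `X` is bounded by the boundary energy `2 N E / A`, the other by the average `S / N`;
  -- the powers of `N` cancel.
  have hquad : X * (X - 3 * m) ≤ 2 / A * m ^ 2 := by
    rw [hES]
    have h1 : A * X ≤ 2 * N * E := by
      have : A / N / 2 * X ≤ E := by linarith
      calc A * X = 2 * N * (A / N / 2 * X) := by field_simp
        _ ≤ _ := by gcongr
    rw [div_mul_eq_mul_div, le_div_iff₀ hA]
    have h2 : X * A * (N * (X - 3 * m)) ≤ X * A * S := by gcongr
    have h3 : A * X * S ≤ 2 * N * E * S :=
      mul_le_mul_of_nonneg_right h1 (Finset.sum_nonneg fun _ _ => sq_nonneg _)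
    have h4 : N * (X * (X - 3 * m) * A) ≤ N * (2 * (E * S)) := by nlinarith
    exact le_of_mul_le_mul_left h4 hN'
  have hXm : X ≤ (3 + 2 / A) * m := by
    by_contra! hlt
    have hA2 : 0 < 2 / A := by positivity
    have h1 : 2 / A * m < X - 3 * m := by linarith
    have h2 : m ≤ X := by nlinarith [mul_nonneg hA2.le hm]
    have hXpos : 0 < X := lt_of_le_of_lt (by positivity) hlt
    have h3 : X * (2 / A * m) < X * (X - 3 * m) := mul_lt_mul_of_pos_left h1 hXpos
    have h4 : m * (2 / A * m) ≤ X * (2 / A * m) := mul_le_mul_of_nonneg_right h2 (by positivity)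
    nlinarith
  have := (abs_le.1 (hvar x hx)).2
  linarith

/-- Nash inequality, normalised to total mass at most one: `‖f‖₂² ≤ ‖f‖_∞ ‖f‖₁` with the sup norm
bounded by `sq_le_sqrt_dirichletForm`. -/
theorem nash_inequality {N : ℕ} (hN : 1 ≤ N) {A : ℝ} (hA : 0 < A) {f : ℕ → ℝ} {E : ℝ}
    (hE : 1 / 2 * ∑ i ∈ Finset.range N, (f (i + 1) - f i) ^ 2 + A / N / 2 * f 0 ^ 2 ≤ E)
    (hf : ∀ x ≤ N, 0 ≤ f x) (hf1 : ∑ i ∈ Finset.range (N + 1), f i ≤ 1) :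
    (∑ i ∈ Finset.range (N + 1), f i ^ 2) ^ 3 ≤ (6 + 2 / A) ^ 2 * E := by
  have hE0 : 0 ≤ E := le_trans (by positivity) hE
  have hsq := fun x (hx : x ≤ N) => sq_le_sqrt_dirichletForm hN hA f hE hx
  set S := ∑ i ∈ Finset.range (N + 1), f i ^ 2 with hS
  have hS0 : 0 ≤ S := Finset.sum_nonneg fun _ _ => sq_nonneg _
  set c := 6 + 2 / A
  have hc : 0 < c := by positivity
  have hSM : S ≤ √(c * √(E * S)) := by
    calc S ≤ ∑ i ∈ Finset.range (N + 1), √(c * √(E * S)) * f i := by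
          refine Finset.sum_le_sum fun i hi => ?_
          have hi' := Nat.lt_succ_iff.1 (Finset.mem_range.1 hi)
          rw [sq]
          exact mul_le_mul_of_nonneg_right (Real.le_sqrt_of_sq_le (hsq i hi')) (hf i hi')
      _ ≤ √(c * √(E * S)) := by
          rw [← Finset.mul_sum]; exact mul_le_of_le_one_right (Real.sqrt_nonneg _) hf1
  rcases hS0.eq_or_lt with h0 | hpos
  · rw [← h0, zero_pow three_ne_zero]; positivity
  have h2 : S ^ 2 ≤ c * √(E * S) := (Real.le_sqrt hS0 (by positivity)).1 hSM
  have h4 : (S ^ 2) ^ 2 ≤ c ^ 2 * (E * S) := by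
    calc (S ^ 2) ^ 2 ≤ (c * √(E * S)) ^ 2 := by gcongr
      _ = _ := by rw [mul_pow, Real.sq_sqrt (by positivity)]
  exact le_of_mul_le_mul_right (by nlinarith : S ^ 3 * S ≤ c ^ 2 * E * S) hpos

/-- Integrated form of `u³ ≤ -k u'`: the derivative of `u⁻²` is at least `2 / k`. -/
theorem mul_sq_le_of_cube_le_neg_deriv {u u' : ℝ → ℝ} {k : ℝ} (hk : 0 < k)
    (hu : ∀ t, 0 ≤ t → 0 < u t) (hd : ∀ t, HasDerivAt u (u' t) t)
    (h : ∀ t, 0 ≤ t → u t ^ 3 ≤ -k * u' t) {t : ℝ} (ht : 0 ≤ t) : t * u t ^ 2 ≤ k := by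
  have hder : ∀ s, 0 ≤ s → HasDerivAt (fun s => (u s ^ 2)⁻¹ - s / k)
      (-(2 * u s * u' s) / (u s ^ 2) ^ 2 - 1 / k) s := by
    intro s hs
    have h1 := ((hd s).pow 2).inv (pow_pos (hu s hs) 2).ne'
    have h2 := h1.sub ((hasDerivAt_id s).div_const k)
    refine HasDerivAt.congr_deriv (f := fun s => (u s ^ 2)⁻¹ - s / k) h2 ?_
    simp
  have hmono : MonotoneOn (fun s => (u s ^ 2)⁻¹ - s / k) (Set.Ici 0) := by
    refine monotoneOn_of_deriv_nonneg (convex_Ici 0)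
      (fun s hs => (hder s hs).continuousAt.continuousWithinAt)
      (fun s hs => (hder s (interior_subset hs)).differentiableAt.differentiableWithinAt) ?_
    intro s hs
    have hs0 : 0 ≤ s := interior_subset hs
    have hup := hu s hs0
    rw [(hder s hs0).deriv, sub_nonneg, div_le_div_iff₀ hk (by positivity)]
    have h3 : u s * u s ^ 3 ≤ u s * (-k * u' s) := mul_le_mul_of_nonneg_left (h s hs0) hup.le
    nlinarith [pow_pos hup 4]
  have h0 := hmono (Set.mem_Ici.2 le_rfl) (Set.mem_Ici.2 ht) ht
  have hup := hu t ht
  have h1 : t / k ≤ (u t ^ 2)⁻¹ := by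
    have : 0 < (u 0 ^ 2)⁻¹ := by have := hu 0 le_rfl; positivity
    simp only [zero_div, sub_zero] at h0
    linarith
  rw [div_le_iff₀ hk, ← div_eq_inv_mul, le_div_iff₀ (by positivity)] at h1
  exact h1

theorem elasticKernel_self_le {N : ℕ} (hN : 1 ≤ N) {A a b : ℝ} (hA : 0 < A) (haA : a = 1 - A / N)
    (ha : 0 ≤ a) (hb : 0 ≤ b) (hb1 : b ≤ 1) {t : ℝ} (ht : 0 ≤ t) (x : Fin (N + 1)) :
    elasticKernel N a b t x x ≤ (6 + 2 / A) / √(max 1 t) := by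
  obtain ⟨κ, φ, h⟩ := exists_isElasticSpectrum N a b
  have ha1 : a ≤ 1 := by rw [haA]; linarith [show 0 ≤ A / N by positivity]
  have hκ := h.eigenvalue_bounds ha ha1 hb hb1
  set c := 6 + 2 / A with hc
  have hA2 : 0 < 2 / A := by positivity
  have hc1 : 1 ≤ c := by linarith
  have hu : ∀ t, elasticKernel N a b t x x = ∑ j, Real.exp (-(t * κ j)) * φ j x ^ 2 := by
    intro t; simp only [h.elasticKernel_eq, sq]
  have hone : ∑ j, φ j x ^ 2 = 1 := by simpa [sq] using h.complete x x
  have hpos : ∀ t, 0 < elasticKernel N a b t x x := by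
    intro t
    rw [hu]
    refine lt_of_le_of_ne (Finset.sum_nonneg fun j _ => by positivity) fun h0 => ?_
    have h1 := (Finset.sum_eq_zero_iff_of_nonneg fun j _ => by positivity).1 h0.symm
    have h2 : ∀ j, φ j x ^ 2 = 0 := fun j =>
      (mul_eq_zero.1 (h1 j (Finset.mem_univ j))).resolve_left (Real.exp_pos _).ne'
    simp [h2] at hone
  have hle1 : elasticKernel N a b t x x ≤ 1 := by
    rw [hu, ← hone]
    refine Finset.sum_le_sum fun j _ => mul_le_of_le_one_left (sq_nonneg _) ?_
    rw [Real.exp_le_one_iff]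
    linarith [mul_nonneg ht (hκ j).1]
  have hder : ∀ t, HasDerivAt (fun t => elasticKernel N a b t x x)
      (-∑ j, κ j * Real.exp (-(t * κ j)) * φ j x ^ 2) t := by
    intro t
    simp only [hu, ← Finset.sum_neg_distrib]
    refine HasDerivAt.fun_sum fun j _ => ?_
    have := ((((hasDerivAt_id t).mul_const (κ j)).neg).exp).mul_const (φ j x ^ 2)
    refine HasDerivAt.congr_deriv (f := fun t => Real.exp (-(t * κ j)) * φ j x ^ 2) this ?_
    simp only [Pi.neg_apply, id]
    ring
  have hdiff : ∀ t, 0 ≤ t → elasticKernel N a b t x x ^ 3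
      ≤ -c ^ 2 * -∑ j, κ j * Real.exp (-(t * κ j)) * φ j x ^ 2 := by
    intro t ht
    have hf : ∀ y : Fin (N + 1), robinKernel N a b (t / 2) (y : ℕ) x
        = elasticKernel N a b (t / 2) x y := fun y => by
      rw [robinKernel_coe, h.elasticKernel_symm]
    have hn := nash_inequality hN hA (f := fun y : ℕ => robinKernel N a b (t / 2) (y : ℤ) x)
      (E := ∑ j, κ j * Real.exp (-(t * κ j)) * φ j x ^ 2) ?_ ?_ ?_
    · rw [← Fin.sum_univ_eq_sum_range (fun y : ℕ => robinKernel N a b (t / 2) (y : ℤ) x ^ 2)] at hn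
      simp only [hf, sq] at hn
      have hs : ∑ y, elasticKernel N a b (t / 2) x y * elasticKernel N a b (t / 2) x y
          = elasticKernel N a b t x x := by
        conv_lhs =>
          enter [2, y, 2]
          rw [h.elasticKernel_symm]
        rw [h.elasticKernel_semigroup, add_halves]
      rw [hs] at hn
      rw [neg_mul_neg]
      simpa only [sq] using hn
    · rw [← h.dirichletForm_elasticKernel]
      have hd := dirichletForm_eq N a b (fun y : ℕ => robinKernel N a b (t / 2) (y : ℤ) x)
      simp only [hf] at hd
      rw [hd]
      have : 0 ≤ (1 - b) / 2 * robinKernel N a b (t / 2) (N : ℕ) x ^ 2 :=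
        mul_nonneg (by linarith) (sq_nonneg _)
      have hAN : (1 - a) / 2 = A / N / 2 := by rw [haA]; ring
      rw [hAN]
      push_cast at this ⊢
      linarith
    · intro y hy
      have := hf ⟨y, by omega⟩
      simp only at this ⊢
      rw [this]
      exact elasticKernel_nonneg ha hb (by positivity) _ _
    · rw [← Fin.sum_univ_eq_sum_range (fun y : ℕ => robinKernel N a b (t / 2) (y : ℤ) x)]
      simp only [hf]
      exact sum_elasticKernel_le_one ha ha1 hb hb1 (by positivity) x
  have hmain := mul_sq_le_of_cube_le_neg_deriv (k := c ^ 2) (by positivity)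
    (fun t _ => hpos t) hder hdiff ht
  rw [le_div_iff₀ (by positivity)]
  rcases le_total t 1 with h1 | h1
  · rw [max_eq_left h1, Real.sqrt_one, mul_one]; exact hle1.trans hc1
  · rw [max_eq_right h1]
    refine (sq_le_sq₀ (by have := hpos t; positivity) (by positivity)).1 ?_
    rw [mul_pow, Real.sq_sqrt ht, mul_comm]
    exact hmain

/-! ### Off-diagonal and time increment bounds -/

namespace IsElasticSpectrum

variable {N : ℕ} {a b : ℝ} {κ : Fin (N + 1) → ℝ} {φ : Fin (N + 1) → Fin (N + 1) → ℝ}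

/-- The off-diagonal spectral sum is controlled by the diagonal values of the kernel. -/
theorem sum_exp_abs_mul_le (h : IsElasticSpectrum N a b κ φ) {t M : ℝ}
    (hM : ∀ x, elasticKernel N a b t x x ≤ M) (x y : Fin (N + 1)) :
    ∑ j, Real.exp (-(t * κ j)) * |φ j x * φ j y| ≤ M := by
  calc ∑ j, Real.exp (-(t * κ j)) * |φ j x * φ j y|
      ≤ ∑ j, (1 / 2 * (Real.exp (-(t * κ j)) * (φ j x * φ j x))
          + 1 / 2 * (Real.exp (-(t * κ j)) * (φ j y * φ j y))) := by
        refine Finset.sum_le_sum fun j _ => ?_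
        rw [abs_mul, ← abs_mul_abs_self (φ j x), ← abs_mul_abs_self (φ j y)]
        nlinarith [mul_nonneg (Real.exp_pos (-(t * κ j))).le (sq_nonneg (|φ j x| - |φ j y|))]
    _ = 1 / 2 * elasticKernel N a b t x x + 1 / 2 * elasticKernel N a b t y y := by
        rw [Finset.sum_add_distrib, ← Finset.mul_sum, ← Finset.mul_sum, h.elasticKernel_eq,
          h.elasticKernel_eq]
    _ ≤ M := by linarith [hM x, hM y]

/-- Analyticity of the semigroup: `κ e^{-tκ} ≤ (2 / t) e^{-tκ/2}` turns the on-diagonal decay into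
a bound on the time derivative with an additional factor `t⁻¹`. -/
theorem sum_mul_exp_abs_mul_le (h : IsElasticSpectrum N a b κ φ) {c : ℝ} (hc : 1 ≤ c)
    (hκ : ∀ j, 0 ≤ κ j ∧ κ j ≤ 2)
    (hdiag : ∀ t, 0 ≤ t → ∀ x, elasticKernel N a b t x x ≤ c / √(max 1 t)) {t : ℝ} (ht : 0 ≤ t)
    (x y : Fin (N + 1)) :
    ∑ j, κ j * Real.exp (-(t * κ j)) * |φ j x * φ j y| ≤ 4 * c / √(max 1 t) ^ 3 := by
  rcases le_total t 1 with h1 | h1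
  · rw [max_eq_left h1, Real.sqrt_one, one_pow, div_one]
    have h0 : ∑ j, Real.exp (-(0 * κ j)) * |φ j x * φ j y| ≤ c :=
      h.sum_exp_abs_mul_le (fun x => by simpa using hdiag 0 le_rfl x) x y
    calc ∑ j, κ j * Real.exp (-(t * κ j)) * |φ j x * φ j y|
        ≤ ∑ j, 2 * (Real.exp (-(0 * κ j)) * |φ j x * φ j y|) := by
          refine Finset.sum_le_sum fun j _ => ?_
          rw [← mul_assoc, zero_mul]
          refine mul_le_mul_of_nonneg_right (mul_le_mul (hκ j).2 ?_ (Real.exp_pos _).le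
            (by norm_num)) (abs_nonneg _)
          exact Real.exp_le_exp.2 (neg_le_neg (mul_nonneg ht (hκ j).1))
      _ ≤ 4 * c := by rw [← Finset.mul_sum]; linarith
  · have htp : 0 < t := by linarith
    rw [max_eq_right h1]
    have hst : √t ^ 2 = t := Real.sq_sqrt ht
    have hsp : 0 < √t := Real.sqrt_pos.2 htp
    have hhalf : ∀ x, elasticKernel N a b (t / 2) x x ≤ 2 * c / √t := by
      intro x
      refine (hdiag (t / 2) (by positivity) x).trans ?_
      rw [div_le_div_iff₀ (by positivity) hsp, mul_comm (2 * c), ← mul_assoc, mul_comm c]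
      refine mul_le_mul_of_nonneg_right ?_ (by linarith)
      rw [mul_comm]
      refine Real.sqrt_le_iff.2 ⟨by positivity, ?_⟩
      rw [mul_pow, Real.sq_sqrt (by positivity)]
      linarith [le_max_right 1 (t / 2)]
    calc ∑ j, κ j * Real.exp (-(t * κ j)) * |φ j x * φ j y|
        ≤ ∑ j, 2 / t * (Real.exp (-(t / 2 * κ j)) * |φ j x * φ j y|) := by
          refine Finset.sum_le_sum fun j _ => ?_
          rw [← mul_assoc]
          refine mul_le_mul_of_nonneg_right ?_ (abs_nonneg _)
          rw [div_mul_eq_mul_div, le_div_iff₀ htp]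
          have he : Real.exp (-(t * κ j))
              = Real.exp (-(t / 2 * κ j)) * Real.exp (-(t / 2 * κ j)) := by
            rw [← Real.exp_add]; ring_nf
          have hle : t / 2 * κ j * Real.exp (-(t / 2 * κ j)) ≤ 1 := by
            rw [Real.exp_neg, ← div_eq_mul_inv, div_le_one (Real.exp_pos _)]
            linarith [Real.add_one_le_exp (t / 2 * κ j)]
          rw [he]
          nlinarith [Real.exp_pos (-(t / 2 * κ j))]
      _ ≤ 2 / t * (2 * c / √t) := by
          rw [← Finset.mul_sum]
          exact mul_le_mul_of_nonneg_left (h.sum_exp_abs_mul_le hhalf x y) (by positivity)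
      _ = 4 * c / √t ^ 3 := by
          rw [pow_succ, hst, div_mul_div_comm]; ring

theorem elasticKernel_le (h : IsElasticSpectrum N a b κ φ) {t M : ℝ}
    (hM : ∀ x, elasticKernel N a b t x x ≤ M) (x y : Fin (N + 1)) :
    elasticKernel N a b t x y ≤ M := by
  refine le_trans ?_ (h.sum_exp_abs_mul_le hM x y)
  rw [h.elasticKernel_eq]
  exact Finset.sum_le_sum fun j _ =>
    mul_le_mul_of_nonneg_left (le_abs_self _) (Real.exp_pos _).le

theorem abs_elasticKernel_sub_le (h : IsElasticSpectrum N a b κ φ) {t t' M : ℝ} (htt : t ≤ t')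
    {x y : Fin (N + 1)} (hM : ∑ j, κ j * Real.exp (-(t * κ j)) * |φ j x * φ j y| ≤ M)
    (hκ : ∀ j, 0 ≤ κ j) :
    |elasticKernel N a b t' x y - elasticKernel N a b t x y| ≤ M * (t' - t) := by
  rw [h.elasticKernel_eq, h.elasticKernel_eq, ← Finset.sum_sub_distrib]
  refine (Finset.abs_sum_le_sum_abs _ _).trans ?_
  refine le_trans ?_ (mul_le_mul_of_nonneg_right hM (sub_nonneg.2 htt))
  rw [Finset.sum_mul]
  refine Finset.sum_le_sum fun j _ => ?_
  rw [← sub_mul, abs_mul, mul_right_comm]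
  refine mul_le_mul_of_nonneg_right ?_ (abs_nonneg _)
  have he : Real.exp (-(t' * κ j))
      = Real.exp (-(t * κ j)) * Real.exp (-((t' - t) * κ j)) := by
    rw [← Real.exp_add]; ring_nf
  have h0 : 0 ≤ (t' - t) * κ j := mul_nonneg (sub_nonneg.2 htt) (hκ j)
  have h1 : Real.exp (-((t' - t) * κ j)) ≤ 1 := Real.exp_le_one_iff.2 (neg_nonpos.2 h0)
  have h2 := Real.add_one_le_exp (-((t' - t) * κ j))
  have hp := Real.exp_pos (-(t * κ j))
  rw [he, abs_sub_comm, abs_of_nonneg (by nlinarith)]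
  nlinarith

end IsElasticSpectrum

/-! ### Interpolation of exponents -/

/-- The elementary form of interpolation between exponents `0` and `1`. -/
theorem min_one_le_rpow {q v : ℝ} (hq : 0 ≤ q) (hv0 : 0 ≤ v) (hv1 : v ≤ 1) :
    min 1 q ≤ q ^ v := by
  rcases le_total q 1 with h | h
  · exact (min_le_right _ _).trans (Real.self_le_rpow_of_le_one hq h hv1)
  · exact (min_le_left _ _).trans (Real.one_le_rpow h hv0)

theorem capPow_add (t r r' : ℝ) : capPow t (r + r') = capPow t r * capPow t r' := by
  unfold capPow
  rw [neg_add, Real.rpow_add (by positivity)]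

theorem capPow_mul_rpow {t q : ℝ} (r v : ℝ) (hq : 0 ≤ q) :
    capPow t (r * v) * q ^ v = (q * capPow t r) ^ v := by
  unfold capPow
  rw [Real.mul_rpow hq (by positivity), ← Real.rpow_mul (by positivity), mul_comm, neg_mul]

theorem capPow_one (t : ℝ) : capPow t 1 = (√(max 1 t) ^ 2)⁻¹ := by
  unfold capPow
  rw [Real.rpow_neg_one, Real.sq_sqrt (by positivity)]

theorem capPow_half (t : ℝ) : capPow t (1 / 2) = (√(max 1 t))⁻¹ := by
  unfold capPow
  rw [Real.rpow_neg (by positivity), Real.sqrt_eq_rpow]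

/-! ### Exponential spatial decay -/

theorem exp_mul_abs_le (l u : ℝ) : Real.exp (l * |u|) ≤ 2 * Real.cosh (l * u) := by
  rw [Real.cosh_eq]
  have h1 := Real.exp_pos (l * u)
  have h2 := Real.exp_pos (-(l * u))
  rcases abs_cases u with ⟨h, _⟩ | ⟨h, _⟩
  · rw [h]; linarith
  · rw [h, mul_neg]; linarith

theorem cosh_sub_one_mul_le {β s t : ℝ} (hs : 1 ≤ s) (ht : t ≤ s ^ 2) (ht0 : 0 ≤ t) :
    (Real.cosh (2 * β / s) - 1) * (t / 2) ≤ β ^ 2 * Real.exp (2 * β ^ 2) := by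
  have hs0 : 0 < s := by linarith
  have h1 : Real.cosh (2 * β / s) ≤ Real.exp (2 * β ^ 2 / s ^ 2) := by
    convert Real.cosh_le_exp_half_sq (2 * β / s) using 2
    field_simp
  have h2 : Real.exp (2 * β ^ 2 / s ^ 2) - 1 ≤ 2 * β ^ 2 / s ^ 2 * Real.exp (2 * β ^ 2) := by
    have h3 : Real.exp (2 * β ^ 2 / s ^ 2) ≤ Real.exp (2 * β ^ 2) :=
      Real.exp_le_exp.2 (div_le_self (by positivity) (one_le_pow₀ hs))
    set w := 2 * β ^ 2 / s ^ 2
    have hw : 0 ≤ w := by positivity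
    have h4 : 1 - w ≤ Real.exp (-w) := by linarith [Real.add_one_le_exp (-w)]
    have h5 : Real.exp (-w) * Real.exp w = 1 := by rw [← Real.exp_add]; simp
    have h6 : (1 - w) * Real.exp w ≤ 1 := by
      exact (mul_le_mul_of_nonneg_right h4 (Real.exp_pos _).le).trans h5.le
    nlinarith [mul_le_mul_of_nonneg_left h3 hw]
  calc (Real.cosh (2 * β / s) - 1) * (t / 2)
      ≤ (2 * β ^ 2 / s ^ 2 * Real.exp (2 * β ^ 2)) * (s ^ 2 / 2) :=
        mul_le_mul (by linarith) (by linarith) (by positivity) (by positivity)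
    _ = β ^ 2 * Real.exp (2 * β ^ 2) := by field_simp

/-- By the semigroup property one of the two half-time paths covers half of the distance
`|x - y|`; its exponential moment gives the decay and the sup bound on the other half the factor
`t^{-1/2}`. -/
theorem elasticKernel_le_exp {N : ℕ} {a b c : ℝ} (hc : 0 ≤ c) (ha : 0 ≤ a) (ha1 : a ≤ 1)
    (hb : 0 ≤ b) (hb1 : b ≤ 1)
    (hdiag : ∀ t, 0 ≤ t → ∀ x, elasticKernel N a b t x x ≤ c / √(max 1 t)) {β t : ℝ}
    (hβ : 0 ≤ β) (ht : 0 ≤ t) (x y : Fin (N + 1)) :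
    elasticKernel N a b t x y ≤ 8 * c * Real.exp (β ^ 2 * Real.exp (2 * β ^ 2)) / √(max 1 t)
      * Real.exp (-(β * |((x : ℕ) : ℝ) - ((y : ℕ) : ℝ)| / √(max 1 t))) := by
  obtain ⟨κ, φ, h⟩ := exists_isElasticSpectrum N a b
  set s := √(max 1 t) with hs
  have hs1 : 1 ≤ s := Real.one_le_sqrt.2 (le_max_left _ _)
  have hs0 : 0 < s := by linarith
  have hts : t ≤ s ^ 2 := by rw [Real.sq_sqrt (by positivity)]; exact le_max_right _ _
  set k := elasticKernel N a b (t / 2) with hk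
  have hk0 : ∀ x y, 0 ≤ k x y := fun x y => elasticKernel_nonneg ha hb (by positivity) x y
  have hsup : ∀ x y, k x y ≤ 2 * c / s := by
    intro x y
    refine h.elasticKernel_le (fun x => (hdiag (t / 2) (by positivity) x).trans ?_) x y
    rw [div_le_div_iff₀ (by positivity) hs0, mul_comm 2 c, mul_assoc]
    refine mul_le_mul_of_nonneg_left ?_ hc
    refine Real.sqrt_le_iff.2 ⟨by positivity, ?_⟩
    rw [mul_pow, Real.sq_sqrt (by positivity)]
    rcases max_cases 1 t with h | h <;> rcases max_cases 1 (t / 2) with h' | h' <;> linarith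
  -- Twice the target rate, since the longer of the two halves covers only half of the distance.
  set l := 2 * β / s with hl
  have hl0 : 0 ≤ l := by positivity
  set Q := Real.exp (β ^ 2 * Real.exp (2 * β ^ 2)) with hQ
  have hmom : ∀ x, ∑ z, k x z * (2 * Real.cosh (l * ((z : ℕ) - (x : ℕ) : ℝ))) ≤ 2 * Q := by
    intro x
    have h1 := sum_elasticKernel_mul_cosh_le (t := t / 2) l ha ha1 hb hb1 (by positivity) x
    have h2 : Real.exp ((Real.cosh l - 1) * (t / 2)) ≤ Q :=
      Real.exp_le_exp.2 (cosh_sub_one_mul_le hs1 hts ht)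
    simp only [mul_left_comm _ (2 : ℝ), ← Finset.mul_sum]
    linarith
  set r := |((x : ℕ) : ℝ) - ((y : ℕ) : ℝ)| with hr
  have hsplit : ∀ z : Fin (N + 1), Real.exp (β * r / s)
      ≤ 2 * Real.cosh (l * ((z : ℕ) - (x : ℕ) : ℝ))
        + 2 * Real.cosh (l * ((z : ℕ) - (y : ℕ) : ℝ)) := by
    intro z
    have htri : r ≤ |((z : ℕ) : ℝ) - ((x : ℕ) : ℝ)| + |((z : ℕ) : ℝ) - ((y : ℕ) : ℝ)| := by
      rw [abs_sub_comm ((z : ℕ) : ℝ)]; exact abs_sub_le _ _ _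
    have e1 := exp_mul_abs_le l (((z : ℕ) : ℝ) - ((x : ℕ) : ℝ))
    have e2 := exp_mul_abs_le l (((z : ℕ) : ℝ) - ((y : ℕ) : ℝ))
    have hlr : ∀ m, r ≤ 2 * m → β * r / s ≤ l * m := by
      intro m hm
      rw [hl, div_mul_eq_mul_div]
      refine div_le_div_of_nonneg_right ?_ hs0.le
      nlinarith
    rcases le_total |((z : ℕ) : ℝ) - ((x : ℕ) : ℝ)| |((z : ℕ) : ℝ) - ((y : ℕ) : ℝ)| with hle | hle
    · refine (Real.exp_le_exp.2 (hlr _ (by linarith))).trans (e2.trans ?_)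
      linarith [Real.cosh_pos (l * ((z : ℕ) - (x : ℕ) : ℝ))]
    · refine (Real.exp_le_exp.2 (hlr _ (by linarith))).trans (e1.trans ?_)
      linarith [Real.cosh_pos (l * ((z : ℕ) - (y : ℕ) : ℝ))]
  have hmain : elasticKernel N a b t x y * Real.exp (β * r / s) ≤ 8 * c * Q / s := by
    have hsg : elasticKernel N a b t x y = ∑ z, k x z * k z y := by
      rw [hk, h.elasticKernel_semigroup, add_halves]
    calc elasticKernel N a b t x y * Real.exp (β * r / s)
        = ∑ z, k x z * k z y * Real.exp (β * r / s) := by rw [hsg, Finset.sum_mul]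
      _ ≤ ∑ z, (2 * c / s * (k x z * (2 * Real.cosh (l * ((z : ℕ) - (x : ℕ) : ℝ))))
            + 2 * c / s * (k y z * (2 * Real.cosh (l * ((z : ℕ) - (y : ℕ) : ℝ))))) := by
          refine Finset.sum_le_sum fun z _ => ?_
          have hsym : k z y = k y z := h.elasticKernel_symm _ z y
          refine (mul_le_mul_of_nonneg_left (hsplit z)
            (mul_nonneg (hk0 x z) (hk0 z y))).trans ?_
          rw [mul_add]
          refine add_le_add ?_ ?_
          · calc _ = k z y * (k x z * (2 * Real.cosh (l * ((z : ℕ) - (x : ℕ) : ℝ)))) := by ring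
              _ ≤ _ := mul_le_mul_of_nonneg_right (hsup z y) (mul_nonneg (hk0 x z)
                (by have := Real.cosh_pos (l * ((z : ℕ) - (x : ℕ) : ℝ)); positivity))
          · rw [← hsym]
            calc _ = k x z * (k z y * (2 * Real.cosh (l * ((z : ℕ) - (y : ℕ) : ℝ)))) := by ring
              _ ≤ _ := mul_le_mul_of_nonneg_right (hsup x z) (mul_nonneg (hk0 z y)
                (by have := Real.cosh_pos (l * ((z : ℕ) - (y : ℕ) : ℝ)); positivity))
      _ ≤ 2 * c / s * (2 * Q) + 2 * c / s * (2 * Q) := by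
          rw [Finset.sum_add_distrib, ← Finset.mul_sum, ← Finset.mul_sum]
          have : 0 ≤ 2 * c / s := by positivity
          exact add_le_add (mul_le_mul_of_nonneg_left (hmom x) this)
            (mul_le_mul_of_nonneg_left (hmom y) this)
      _ = 8 * c * Q / s := by ring
  rw [Real.exp_neg, ← div_eq_mul_inv, le_div_iff₀ (Real.exp_pos _)]
  exact hmain

/-! ### Spatial gradient -/

/-- Interpolation of the gradient between the values at the endpoints of an interval of length `L`
and the second difference inside it. -/
theorem abs_succ_sub_le_of_second_difference {q : ℕ → ℝ} {L : ℕ} {m D : ℝ}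
    (h0 : 0 ≤ q 0 ∧ q 0 ≤ m) (hL : 0 ≤ q L ∧ q L ≤ m) (hD0 : 0 ≤ D)
    (hD : ∀ z, z + 1 < L → |q (z + 2) - 2 * q (z + 1) + q z| ≤ D) {i : ℕ} (hi : i < L) :
    |q (i + 1) - q i| ≤ m / L + (L - 1) * D := by
  have hLp : (0 : ℝ) < L := by exact_mod_cast (by omega : 0 < L)
  have hup : ∀ i k : ℕ, i + k < L →
      |(q (i + k + 1) - q (i + k)) - (q (i + 1) - q i)| ≤ k * D := by
    intro i k
    induction k with
    | zero => intro _; simp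
    | succ k ih =>
      intro hk
      have h1 := ih (by omega)
      have h2 := hD (i + k) (by omega)
      calc |(q (i + (k + 1) + 1) - q (i + (k + 1))) - (q (i + 1) - q i)|
          = |(q (i + k + 2) - 2 * q (i + k + 1) + q (i + k))
              + ((q (i + k + 1) - q (i + k)) - (q (i + 1) - q i))| := by
            rw [show i + (k + 1) + 1 = i + k + 2 by ring, show i + (k + 1) = i + k + 1 by ring]
            ring_nf
        _ ≤ D + k * D := (abs_add_le _ _).trans (add_le_add h2 h1)
        _ = (k + 1 : ℕ) * D := by push_cast; ring
  have hosc : ∀ j < L, |(q (j + 1) - q j) - (q (i + 1) - q i)| ≤ (L - 1) * D := by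
    have hle : ∀ k : ℕ, k + 1 ≤ L → (k : ℝ) * D ≤ (L - 1) * D := fun k hk => by
      have : (k : ℝ) + 1 ≤ L := by exact_mod_cast hk
      exact mul_le_mul_of_nonneg_right (by linarith) hD0
    intro j hj
    rcases le_total i j with hij | hij
    · obtain ⟨k, rfl⟩ := Nat.exists_eq_add_of_le hij
      exact (hup i k hj).trans (hle k (by omega))
    · obtain ⟨k, rfl⟩ := Nat.exists_eq_add_of_le hij
      rw [abs_sub_comm]
      exact (hup j k hi).trans (hle k (by omega))
  have hsum : (L : ℝ) * (q (i + 1) - q i) = (q L - q 0)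
      - ∑ j ∈ Finset.range L, ((q (j + 1) - q j) - (q (i + 1) - q i)) := by
    rw [Finset.sum_sub_distrib, Finset.sum_range_sub, Finset.sum_const, Finset.card_range,
      nsmul_eq_mul]
    ring
  have hends : |q L - q 0| ≤ m := abs_le.2 ⟨by linarith, by linarith⟩
  have hrest : |∑ j ∈ Finset.range L, ((q (j + 1) - q j) - (q (i + 1) - q i))|
      ≤ L * ((L - 1) * D) := by
    refine (Finset.abs_sum_le_sum_abs _ _).trans ?_
    refine (Finset.sum_le_sum fun j hj => hosc j (Finset.mem_range.1 hj)).trans ?_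
    rw [Finset.sum_const, Finset.card_range, nsmul_eq_mul]
  have habs : (L : ℝ) * |q (i + 1) - q i| ≤ m + L * ((L - 1) * D) := by
    rw [← abs_of_pos hLp, ← abs_mul, abs_of_pos hLp, hsum]
    exact (abs_sub _ _).trans (add_le_add hends hrest)
  refine le_of_mul_le_mul_left (habs.trans (le_of_eq ?_)) hLp
  rw [mul_add, mul_div_cancel₀ _ hLp.ne']

theorem abs_sub_le_of_abs_succ_sub_le {F : ℤ → ℝ} {u w : ℤ} {D : ℝ} (huw : u ≤ w)
    (h : ∀ z, u ≤ z → z < w → |F (z + 1) - F z| ≤ D) : |F w - F u| ≤ (w - u : ℤ) * D := by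
  induction w, huw using Int.leInduction with
  | base => simp
  | succ w huw ih =>
    have h1 := ih fun z h1 h2 => h z h1 (by omega)
    have h2 := h w huw (by omega)
    calc |F (w + 1) - F u| = |(F (w + 1) - F w) + (F w - F u)| := by ring_nf
      _ ≤ D + (w - u : ℤ) * D := (abs_add_le _ _).trans (add_le_add h2 h1)
      _ = _ := by push_cast; ring

/-- Moving the base point by at most `k s` costs a factor `exp (β k)` in the decay. -/
theorem exp_neg_mul_abs_le {β s k x y z : ℝ} (hβ : 0 ≤ β) (hs : 0 < s) (h : |z - x| ≤ k * s) :
    Real.exp (-(β * |z - y| / s)) ≤ Real.exp (β * k) * Real.exp (-(β * |x - y| / s)) := by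
  rw [← Real.exp_add, Real.exp_le_exp]
  have h1 : |x - y| ≤ k * s + |z - y| := by
    rw [abs_sub_comm] at h
    exact (abs_sub_le x z y).trans (by linarith)
  have h2 : β * |x - y| / s ≤ β * k + β * |z - y| / s := by
    rw [div_le_iff₀ hs, add_mul, div_mul_cancel₀ _ hs.ne']
    nlinarith [mul_le_mul_of_nonneg_left h1 hβ]
  linarith

section Gradient

variable {N : ℕ} {a b t s M β θ D : ℝ}

/-- The gradient bound inside the interval. The constant `θ` bounds `s / N`, the kernel decays at
rate `2 * β`, and `D / s ^ 3` bounds its time derivative. On an interval around `x` of length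
`L ≈ s exp (-β |x - y| / s)`, the term `m / L` keeps half of the exponential decay of the kernel,
and the length itself supplies the decay of the second difference term `(L - 1) D`. -/
theorem abs_robinKernel_succ_sub_le_of_lt (hs : 1 ≤ s) (hθ : s ≤ θ * N) (hN : 1 ≤ N) (hβ : 0 ≤ β)
    (hM : 0 ≤ M) (hD0 : 0 ≤ D)
    (hnn : ∀ x y : Fin (N + 1), 0 ≤ elasticKernel N a b t x y)
    (hdecay : ∀ x y : Fin (N + 1), elasticKernel N a b t x y
      ≤ M / s * Real.exp (-(2 * β * |((x : ℕ) : ℝ) - ((y : ℕ) : ℝ)| / s)))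
    (hD : ∀ x y : Fin (N + 1), |elasticKernel N a b t x y
      - ∑ z, elasticStep N a b x z * elasticKernel N a b t z y| ≤ D / s ^ 3)
    {x : ℕ} (hx : x < N) (y : Fin (N + 1)) :
    |robinKernel N a b t ((x : ℤ) + 1) y - robinKernel N a b t (x : ℤ) y|
      ≤ (M * Real.exp (4 * β) * (θ + 1) + 2 * D) / s ^ 2
        * Real.exp (-(β * |(x : ℝ) - ((y : ℕ) : ℝ)| / s)) := by
  have hs0 : 0 < s := by linarith
  have hN0 : (0 : ℝ) < N := by exact_mod_cast hN
  have hθ0 : 0 < θ := by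
    by_contra! hle
    linarith [mul_nonpos_of_nonpos_of_nonneg hle hN0.le]
  set ρ := β * |(x : ℝ) - ((y : ℕ) : ℝ)| / s with hρ
  have hρ0 : 0 ≤ ρ := by positivity
  have he1 : Real.exp (-ρ) ≤ 1 := Real.exp_le_one_iff.2 (by linarith)
  have hep := Real.exp_pos (-ρ)
  have hcl := Nat.ceil_lt_add_one (mul_nonneg hs0.le hep.le)
  have hcu := Nat.le_ceil (s * Real.exp (-ρ))
  have hcp : 0 < ⌈s * Real.exp (-ρ)⌉₊ := Nat.ceil_pos.2 (by positivity)
  have hse : s * Real.exp (-ρ) ≤ s := mul_le_of_le_one_right hs0.le he1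
  obtain ⟨L, hL⟩ : ∃ L, L = min N ⌈s * Real.exp (-ρ)⌉₊ := ⟨_, rfl⟩
  have hL1 : 1 ≤ L := by omega
  have hLN : L ≤ N := by omega
  have hLp : (0 : ℝ) < L := by exact_mod_cast hL1
  have hLc : (L : ℝ) ≤ ⌈s * Real.exp (-ρ)⌉₊ := by exact_mod_cast (by omega)
  have hLge : s * Real.exp (-ρ) ≤ (θ + 1) * L := by
    rcases le_total N ⌈s * Real.exp (-ρ)⌉₊ with h | h
    · rw [hL, min_eq_left h]; linarith
    · rw [hL, min_eq_right h]
      nlinarith [mul_pos hθ0 (show (0 : ℝ) < ⌈s * Real.exp (-ρ)⌉₊ by exact_mod_cast hcp)]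
  have hLs : (L : ℝ) ≤ 2 * s := by linarith
  -- An interval `[p, p + L]` inside `[0, N]` that contains the edge from `x` to `x + 1`.
  obtain ⟨p, i, hpx, hiL, hpL⟩ : ∃ p i, p + i = x ∧ i < L ∧ p + L ≤ N :=
    ⟨min x (N - L), x - min x (N - L), by omega, by omega, by omega⟩
  have hq : ∀ z, z ≤ N → ∃ w : Fin (N + 1), (w : ℕ) = z ∧
      robinKernel N a b t (z : ℤ) y = elasticKernel N a b t w y := fun z hz =>
    ⟨⟨z, by omega⟩, rfl, robinKernel_coe N a b t ⟨z, by omega⟩ y⟩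
  set m := M / s * (Real.exp (2 * β * 2) * Real.exp (-(2 * ρ))) with hm
  have hend : ∀ z, p ≤ z → z ≤ p + L →
      0 ≤ robinKernel N a b t (z : ℤ) y ∧ robinKernel N a b t (z : ℤ) y ≤ m := by
    intro z h1 h2
    obtain ⟨w, hw, hwq⟩ := hq z (by omega)
    rw [hwq]
    refine ⟨hnn w y, (hdecay w y).trans ?_⟩
    refine mul_le_mul_of_nonneg_left ?_ (by positivity)
    have hzx : |(z : ℝ) - x| ≤ 2 * s := by
      refine le_trans ?_ hLs
      have h3 : (z : ℝ) ≤ x + L := by exact_mod_cast (by omega)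
      have h4 : (x : ℝ) ≤ z + L := by exact_mod_cast (by omega)
      exact abs_le.2 ⟨by linarith, by linarith⟩
    have := exp_neg_mul_abs_le (β := 2 * β) (y := ((y : ℕ) : ℝ)) (by positivity) hs0 hzx
    rw [hw]
    refine this.trans (le_of_eq ?_)
    rw [hρ]; congr 3; ring
  have hmain := abs_succ_sub_le_of_second_difference (L := L) (m := m) (D := 2 * (D / s ^ 3))
    (q := fun z : ℕ => robinKernel N a b t ((p + z : ℕ) : ℤ) y) (hend p le_rfl (by omega))
    (hend (p + L) (by omega) le_rfl) (by positivity) ?_ hiL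
  · simp only [← add_assoc, hpx] at hmain
    push_cast at hmain ⊢
    refine hmain.trans ?_
    have e1 : m / L ≤ M * Real.exp (4 * β) * (θ + 1) / s ^ 2 * Real.exp (-ρ) := by
      have h2 : Real.exp (-(2 * ρ)) = Real.exp (-ρ) * Real.exp (-ρ) := by
        rw [← Real.exp_add]; ring_nf
      rw [div_le_iff₀ hLp, hm, h2, show 2 * β * 2 = 4 * β by ring]
      calc M / s * (Real.exp (4 * β) * (Real.exp (-ρ) * Real.exp (-ρ)))
          = M * Real.exp (4 * β) / s ^ 2 * Real.exp (-ρ) * (s * Real.exp (-ρ)) := by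
            field_simp
        _ ≤ M * Real.exp (4 * β) / s ^ 2 * Real.exp (-ρ) * ((θ + 1) * L) := by gcongr
        _ = _ := by ring
    have e2 : ((L : ℝ) - 1) * (2 * (D / s ^ 3)) ≤ 2 * D / s ^ 2 * Real.exp (-ρ) := by
      calc ((L : ℝ) - 1) * (2 * (D / s ^ 3)) ≤ s * Real.exp (-ρ) * (2 * (D / s ^ 3)) :=
            mul_le_mul_of_nonneg_right (by linarith) (by positivity)
        _ = _ := by field_simp
    calc m / L + ((L : ℝ) - 1) * (2 * (D / s ^ 3)) ≤ _ := add_le_add e1 e2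
      _ = _ := by ring
  · intro z hz
    obtain ⟨w, hw, hwq⟩ := hq (p + z + 1) (by omega)
    have h1 := hD w y
    rw [elasticStep_mul_elasticKernel, ← hwq, hw] at h1
    have h2 : robinKernel N a b t ((p + (z + 2) : ℕ) : ℤ) y
        - 2 * robinKernel N a b t ((p + (z + 1) : ℕ) : ℤ) y
        + robinKernel N a b t ((p + z : ℕ) : ℤ) y
        = -2 * (robinKernel N a b t ((p + z + 1 : ℕ) : ℤ) y
          - 1 / 2 * (robinKernel N a b t (((p + z + 1 : ℕ) : ℤ) + 1) y
            + robinKernel N a b t (((p + z + 1 : ℕ) : ℤ) - 1) y)) := by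
      rw [show (((p + z + 1 : ℕ) : ℤ) + 1) = ((p + (z + 2) : ℕ) : ℤ) by push_cast; ring,
        show (((p + z + 1 : ℕ) : ℤ) - 1) = ((p + z : ℕ) : ℤ) by push_cast; ring,
        show p + (z + 1) = p + z + 1 by ring]
      ring
    rw [h2, abs_mul, abs_neg, abs_two]
    exact mul_le_mul_of_nonneg_left h1 (by norm_num)

/-- The gradient bound across all edges, including those to the exterior points `-1` and `N + 1`,
where the Robin condition makes the difference a multiple of `1 / N ≤ θ / s` of the boundary
value. -/
theorem abs_robinKernel_succ_sub_le {A B : ℝ} (hA : 0 < A) (hB : 0 < B) (haA : a = 1 - A / N)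
    (hbB : b = 1 - B / N) (hs : 1 ≤ s) (hθ : s ≤ θ * N) (hN : 1 ≤ N) (hβ : 0 ≤ β)
    (hM : 0 ≤ M) (hD0 : 0 ≤ D)
    (hnn : ∀ x y : Fin (N + 1), 0 ≤ elasticKernel N a b t x y)
    (hdecay : ∀ x y : Fin (N + 1), elasticKernel N a b t x y
      ≤ M / s * Real.exp (-(2 * β * |((x : ℕ) : ℝ) - ((y : ℕ) : ℝ)| / s)))
    (hD : ∀ x y : Fin (N + 1), |elasticKernel N a b t x y
      - ∑ z, elasticStep N a b x z * elasticKernel N a b t z y| ≤ D / s ^ 3)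
    {z : ℤ} (hz : -1 ≤ z) (hzN : z ≤ N) (y : Fin (N + 1)) :
    |robinKernel N a b t (z + 1) y - robinKernel N a b t z y|
      ≤ (M * Real.exp (4 * β) * (θ + 1) + 2 * D + (A + B) * θ * M * Real.exp β) / s ^ 2
        * Real.exp (-(β * |(z : ℝ) - ((y : ℕ) : ℝ)| / s)) := by
  have hs0 : 0 < s := by linarith
  have hN0 : (0 : ℝ) < N := by exact_mod_cast hN
  have hθ0 : 0 < θ := by
    by_contra! hle
    linarith [mul_nonpos_of_nonpos_of_nonneg hle hN0.le]
  have hNs : 1 / (N : ℝ) ≤ θ / s := by rw [div_le_div_iff₀ hN0 hs0]; linarith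
  have hbd : ∀ (w : Fin (N + 1)) (R : ℝ), 0 < R → R ≤ A + B → |((w : ℕ) : ℝ) - z| ≤ 1 →
      R / N * elasticKernel N a b t w y
      ≤ (M * Real.exp (4 * β) * (θ + 1) + 2 * D + (A + B) * θ * M * Real.exp β) / s ^ 2
        * Real.exp (-(β * |(z : ℝ) - ((y : ℕ) : ℝ)| / s)) := by
    intro w R hR hRAB hwz
    have h1 : elasticKernel N a b t w y
        ≤ M / s * (Real.exp β * Real.exp (-(β * |(z : ℝ) - ((y : ℕ) : ℝ)| / s))) := by
      refine (hdecay w y).trans (mul_le_mul_of_nonneg_left ?_ (by positivity))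
      have h2 := exp_neg_mul_abs_le (k := 1) (y := ((y : ℕ) : ℝ)) hβ hs0
        (hwz.trans (by linarith))
      rw [mul_one] at h2
      refine le_trans (Real.exp_le_exp.2 (neg_le_neg ?_)) h2
      gcongr
      linarith
    have h3 : R / N ≤ (A + B) * (θ / s) := by
      rw [div_eq_mul_one_div]; gcongr
    calc R / N * elasticKernel N a b t w y
        ≤ (A + B) * (θ / s)
          * (M / s * (Real.exp β * Real.exp (-(β * |(z : ℝ) - ((y : ℕ) : ℝ)| / s)))) :=
          mul_le_mul h3 h1 (hnn w y) (by positivity)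
      _ = (A + B) * θ * M * Real.exp β / s ^ 2
          * Real.exp (-(β * |(z : ℝ) - ((y : ℕ) : ℝ)| / s)) := by field_simp
      _ ≤ _ := by
          gcongr
          have : 0 ≤ M * Real.exp (4 * β) * (θ + 1) + 2 * D := by positivity
          linarith
  rcases hz.eq_or_lt with rfl | hz'
  · have h0 := robinKernel_coe N a b t 0 y
    rw [Fin.val_zero, Nat.cast_zero] at h0
    rw [neg_add_cancel, robinKernel_left, h0]
    have h1 : elasticKernel N a b t 0 y - a * elasticKernel N a b t 0 y
        = A / N * elasticKernel N a b t 0 y := by rw [haA]; ring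
    rw [h1, abs_of_nonneg (mul_nonneg (by positivity) (hnn 0 y))]
    exact hbd 0 A hA (by linarith) (by simp)
  rcases hzN.eq_or_lt with rfl | hzN'
  · have h0 := robinKernel_coe N a b t (Fin.last N) y
    rw [Fin.val_last] at h0
    rw [robinKernel_right, h0]
    have h1 : b * elasticKernel N a b t (Fin.last N) y - elasticKernel N a b t (Fin.last N) y
        = -(B / N * elasticKernel N a b t (Fin.last N) y) := by rw [hbB]; ring
    rw [h1, abs_neg, abs_of_nonneg (mul_nonneg (by positivity) (hnn _ y))]
    exact hbd (Fin.last N) B hB (by linarith) (by simp)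
  · lift z to ℕ using (by omega)
    refine (abs_robinKernel_succ_sub_le_of_lt hs hθ hN hβ hM hD0 hnn hdecay hD
      (by exact_mod_cast hzN') y).trans ?_
    rw [Int.cast_natCast]
    have : 0 ≤ (A + B) * θ * M * Real.exp β := by positivity
    refine mul_le_mul_of_nonneg_right (div_le_div_of_nonneg_right ?_ (by positivity))
      (Real.exp_pos _).le
    linarith

end Gradient

/-! ### Assembly of the four bounds -/

theorem mainTheorem8 :
    ∃ C₁ : ℝ, 0 < C₁ ∧
      ∀ A B : ℝ, 0 < A → 0 < B →
        ∃ C₂ : ℝ, 0 < C₂ ∧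
          ∀ Tbar : ℝ, 0 < Tbar → ∀ b : ℝ, 0 ≤ b →
            ∃ C₃ : ℝ, 0 < C₃ ∧
              ∀ (N : ℕ) (ε μA μB : ℝ), 1 ≤ N → ε = 1 / (N : ℝ) →
                μA = 1 - ε * A → μB = 1 - ε * B → 0 < μA → 0 < μB →
                ∀ (t t' v : ℝ), 0 ≤ t → t < t' → t' < ε⁻¹ ^ 2 * Tbar → 0 ≤ v → v ≤ 1 →
                ∀ x y : Fin (N + 1),
                  robinKernel N μA μB t (x : ℕ) y
                      ≤ Real.exp (C₁ * (t' - t)) * robinKernel N μA μB t' (x : ℕ) y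
                  ∧ |robinKernel N μA μB t' (x : ℕ) y - robinKernel N μA μB t (x : ℕ) y|
                      ≤ C₂ * capPow t (1 / 2 + v) * (t' - t) ^ v
                  ∧ robinKernel N μA μB t (x : ℕ) y
                      ≤ C₃ * capPow t (1 / 2)
                          * Real.exp (-(b * |((x : ℕ) : ℝ) - ((y : ℕ) : ℝ)| * capPow t (1 / 2)))
                  ∧ ∀ n : ℤ, |n| ≤ ⌈Real.sqrt t⌉ →
                      -1 ≤ ((x : ℕ) : ℤ) + n → ((x : ℕ) : ℤ) + n ≤ (N : ℤ) + 1 →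
                      |robinKernel N μA μB t (((x : ℕ) : ℤ) + n) y
                          - robinKernel N μA μB t (x : ℕ) y|
                        ≤ C₃ * capPow t ((1 + v) / 2) * |(n : ℝ)| ^ v
                            * Real.exp
                                (-(b * |((x : ℕ) : ℝ) - ((y : ℕ) : ℝ)| * capPow t (1 / 2))) := by
  refine ⟨1, one_pos, fun A B hA hB => ?_⟩
  set c := 6 + 2 / A with hc
  have hA2 : 0 < 2 / A := by positivity
  have hc1 : 1 ≤ c := by linarith
  refine ⟨4 * c, by positivity, fun Tbar hT b hb => ?_⟩
  set M : ℝ → ℝ := fun β => 8 * c * Real.exp (β ^ 2 * Real.exp (2 * β ^ 2)) with hMdef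
  have hM0 : ∀ β, 0 < M β := fun β => by positivity
  set θ := √(1 + Tbar) with hθdef
  have hθ0 : 0 < θ := Real.sqrt_pos.2 (by linarith)
  set H := M (2 * b) * Real.exp (4 * b) * (θ + 1) + 2 * (4 * c)
    + (A + B) * θ * M (2 * b) * Real.exp b with hH
  have hH0 : 0 < H := by have := hM0 (2 * b); positivity
  refine ⟨M b + 2 * (H * Real.exp (b * 2)), by have := hM0 b; positivity, ?_⟩
  intro N ε μA μB hN hε hμA hμB hμA0 hμB0 t t' v ht htt ht'T hv0 hv1 x y
  have hN0 : (0 : ℝ) < N := by exact_mod_cast hN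
  have haA : μA = 1 - A / N := by rw [hμA, hε]; ring
  have hbB : μB = 1 - B / N := by rw [hμB, hε]; ring
  have hμA1 : μA ≤ 1 := by rw [haA]; linarith [show 0 ≤ A / N by positivity]
  have hμB1 : μB ≤ 1 := by rw [hbB]; linarith [show 0 ≤ B / N by positivity]
  obtain ⟨κ, φ, h⟩ := exists_isElasticSpectrum N μA μB
  have hκ := h.eigenvalue_bounds hμA0.le hμA1 hμB0.le hμB1
  have hdiag : ∀ t, 0 ≤ t → ∀ x, elasticKernel N μA μB t x x ≤ c / √(max 1 t) :=
    fun t ht x => elasticKernel_self_le hN hA haA hμA0.le hμB0.le hμB1 ht x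
  have hnn : ∀ t, 0 ≤ t → ∀ x y, 0 ≤ elasticKernel N μA μB t x y :=
    fun t ht x y => elasticKernel_nonneg hμA0.le hμB0.le ht x y
  have hspec := h.sum_mul_exp_abs_mul_le hc1 hκ hdiag ht
  have hdecay := fun β (hβ : 0 ≤ β) => elasticKernel_le_exp (by linarith) hμA0.le hμA1 hμB0.le
    hμB1 hdiag hβ ht
  have hht := capPow_half t
  have hcap1 := capPow_one t
  set s := √(max 1 t) with hs
  have hs1 : 1 ≤ s := Real.one_le_sqrt.2 (le_max_left _ _)
  have hs0 : 0 < s := by linarith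
  refine ⟨?_, ?_, ?_, ?_⟩
  · rw [one_mul, robinKernel_coe, robinKernel_coe]
    exact elasticKernel_le_exp_mul hμA0.le hμB0.le ht htt.le x y
  · rw [robinKernel_coe, robinKernel_coe]
    have hδ : 0 ≤ t' - t := by linarith
    have e1 : |elasticKernel N μA μB t' x y - elasticKernel N μA μB t x y| ≤ c / s := by
      have h1 := h.elasticKernel_le (hdiag t ht) x y
      have h2 := h.elasticKernel_le (hdiag t' (by linarith)) x y
      have h3 : c / √(max 1 t') ≤ c / s := by
        refine div_le_div_of_nonneg_left (by linarith) hs0 (Real.sqrt_le_sqrt ?_)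
        exact max_le_max le_rfl htt.le
      exact abs_le.2 ⟨by linarith [hnn t' (by linarith) x y], by linarith [hnn t ht x y]⟩
    have e2 := h.abs_elasticKernel_sub_le htt.le (hspec x y) fun j => (hκ j).1
    -- `e1` and `e2` are the cases `v = 0` and `v = 1`, with `q = (t' - t) / s²`.
    have e3 := min_one_le_rpow (q := (t' - t) * (s ^ 2)⁻¹) (by positivity) hv0 hv1
    have e4 : |elasticKernel N μA μB t' x y - elasticKernel N μA μB t x y|
        ≤ 4 * c / s * min 1 ((t' - t) * (s ^ 2)⁻¹) := by
      rw [mul_min_of_nonneg _ _ (by positivity)]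
      refine le_min (e1.trans ?_) (e2.trans (le_of_eq ?_))
      · rw [mul_one]; gcongr; linarith
      · field_simp
    calc _ ≤ 4 * c / s * ((t' - t) * (s ^ 2)⁻¹) ^ v :=
          e4.trans (mul_le_mul_of_nonneg_left e3 (by positivity))
      _ = _ := by
          rw [← hcap1, ← capPow_mul_rpow 1 v hδ, one_mul, capPow_add, hht]
          ring
  · rw [robinKernel_coe, hht]
    refine (hdecay b hb x y).trans ?_
    rw [← div_eq_mul_inv, ← div_eq_mul_inv]
    have : 0 < H * Real.exp (b * 2) := by positivity
    refine mul_le_mul_of_nonneg_right ?_ (Real.exp_pos _).le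
    exact div_le_div_of_nonneg_right (by linarith) hs0.le
  · intro n hn hx1 hx2
    have hsθ : s ≤ θ * N := by
      rw [hs, Real.sqrt_le_left (by positivity), mul_pow, hθdef, Real.sq_sqrt (by linarith)]
      have hNsq : (1 : ℝ) ≤ (N : ℝ) ^ 2 := one_le_pow₀ (by exact_mod_cast hN)
      have hTN : t < (N : ℝ) ^ 2 * Tbar := by
        have := htt.trans ht'T
        rwa [hε, one_div, inv_inv] at this
      exact max_le (by nlinarith) (by nlinarith)
    have hgrad := fun z hz1 hz2 => abs_robinKernel_succ_sub_le hA hB haA hbB hs1 hsθ hN hb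
      (hM0 (2 * b)).le (show 0 ≤ 4 * c by positivity) (hnn t ht)
      (hdecay (2 * b) (by positivity)) (fun x y => by
        rw [h.sub_sum_elasticStep_mul]
        refine le_trans (Finset.abs_sum_le_sum_abs _ _) (le_trans (le_of_eq ?_) (hspec x y))
        refine Finset.sum_congr rfl fun j _ => ?_
        rw [abs_mul, abs_of_nonneg (mul_nonneg (hκ j).1 (Real.exp_pos _).le)])
      (z := z) hz1 hz2 y
    have hn2 : |(n : ℝ)| ≤ 2 * s := by
      have h1 : (|n| : ℤ) < √t + 1 := lt_of_le_of_lt (by exact_mod_cast hn) (Int.ceil_lt_add_one _)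
      have h2 : √t ≤ s := Real.sqrt_le_sqrt (le_max_right _ _)
      push_cast at h1
      linarith
    set e := Real.exp (-(b * |((x : ℕ) : ℝ) - ((y : ℕ) : ℝ)| / s)) with he
    have hxN : ((x : ℕ) : ℤ) ≤ N := by exact_mod_cast Nat.lt_succ_iff.1 x.2
    have hedge : ∀ z : ℤ, -1 ≤ z → z ≤ N → |z - (x : ℕ)| ≤ |n| →
        |robinKernel N μA μB t (z + 1) y - robinKernel N μA μB t z y|
          ≤ H / s ^ 2 * (Real.exp (b * 2) * e) := by
      intro z hz1 hz2 hzx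
      refine (hgrad z hz1 hz2).trans ?_
      refine mul_le_mul_of_nonneg_left ?_ (by positivity)
      refine exp_neg_mul_abs_le hb hs0 (le_trans ?_ hn2)
      exact_mod_cast hzx
    have hpath : |robinKernel N μA μB t (((x : ℕ) : ℤ) + n) y - robinKernel N μA μB t (x : ℕ) y|
        ≤ |(n : ℝ)| * (H / s ^ 2 * (Real.exp (b * 2) * e)) := by
      rcases le_total 0 n with h0 | h0
      · have := abs_sub_le_of_abs_succ_sub_le (F := fun z => robinKernel N μA μB t z y)
          (u := (x : ℕ)) (w := (x : ℕ) + n) (by omega)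
          (fun z h1 h2 => hedge z (by omega) (by omega) (by
            rw [abs_of_nonneg (by omega), abs_of_nonneg h0]; omega))
        have hn' : (n : ℝ) = |(n : ℝ)| := (abs_of_nonneg (by exact_mod_cast h0)).symm
        rwa [add_sub_cancel_left, hn'] at this
      · have := abs_sub_le_of_abs_succ_sub_le (F := fun z => robinKernel N μA μB t z y)
          (u := (x : ℕ) + n) (w := (x : ℕ)) (by omega)
          (fun z h1 h2 => hedge z (by omega) (by omega) (by
            rw [abs_of_nonpos (by omega), abs_of_nonpos h0]; omega))
        rw [abs_sub_comm]
        have hn' : ((-n : ℤ) : ℝ) = |(n : ℝ)| := by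
          rw [Int.cast_neg, abs_of_nonpos (by exact_mod_cast h0)]
        rwa [sub_add_cancel_left, hn'] at this
    -- The bound linear in `|n|` suffices for every `v`, because `q = |n| / s` is at most `2`.
    set q := |(n : ℝ)| * s⁻¹ with hq
    have hq0 : 0 ≤ q := by positivity
    have hq2 : q ≤ 2 := by rw [hq, ← div_eq_mul_inv, div_le_iff₀ hs0]; exact hn2
    have hqv : q ≤ 2 * q ^ v := by
      have h1 := min_one_le_rpow hq0 hv0 hv1
      rcases min_cases 1 q with ⟨h2, _⟩ | ⟨h2, _⟩ <;> linarith
    have hcap : capPow t ((1 + v) / 2) * |(n : ℝ)| ^ v = s⁻¹ * q ^ v := by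
      rw [show (1 + v) / 2 = 1 / 2 + 1 / 2 * v by ring, capPow_add, mul_assoc,
        capPow_mul_rpow _ _ (abs_nonneg _), hht]
    rw [hht, mul_assoc (M b + _), hcap, ← div_eq_mul_inv, ← he]
    have hep : 0 < e := Real.exp_pos _
    calc _ ≤ |(n : ℝ)| * (H / s ^ 2 * (Real.exp (b * 2) * e)) := hpath
      _ = H * Real.exp (b * 2) * (s⁻¹ * q) * e := by rw [hq]; field_simp
      _ ≤ H * Real.exp (b * 2) * (s⁻¹ * (2 * q ^ v)) * e := by gcongr
      _ = 2 * (H * Real.exp (b * 2)) * (s⁻¹ * q ^ v) * e := by ring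
      _ ≤ _ := by
          have := hM0 b
          have : 0 ≤ s⁻¹ * q ^ v := by positivity
          gcongr
          linarith
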